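/- Theorem 2. Write $r'$ for the conjugate exponent of $r\in[1,\infty]$, $\frac1r+\frac1{r'}=1$, and $\hat f(\xi)=\int_{\mathbb{R}^n}e^{-ix\cdot\xi}f(x)\,dx$ for the Fourier transform, extended to tempered distributions. Let $n\ge 1$ be an integer, and for $i=1,2$ let $a_i\in(0,\infty]$ and $b_i\in(0,\infty)$ be such that $r_i:=\frac{n}{a_i^{-1}n+b_i}<2$. Suppose $$k_1\in\begin{cases}(r_1,\infty],&\text{if } r_2<1,\\ (r_1,r_2'),&\text{if } r_2\ge1,\end{cases}\qquad k_2\in\begin{cases}(r_2,\infty],&\text{if } r_1<1,\\ (r_2,r_1'),&\text{if } r_1\ge1.\end{cases}$$ Then there is a constant $C>0$, depending only on $n,a_1,a_2,b_1,b_2,k_1,k_2$, such that for all $0\neq f\in L^{k_1}(\mathbb{R}^n)$ with $\hat f\in L^{k_2}(\mathbb{R}^n)$ and all $x_0,\xi_0\in\mathbb{R}^n$, $$\left(\frac{\||x-x_0|^{b_1}f\|_{L^{a_1}(\mathbb{R}^n)}}{\|f\|_{L^{k_1}(\mathbb{R}^n)}}\right)^{\frac1{a_2}+\frac{b_2}{n}-\frac1{k_2}}\left(\frac{\||\xi-\xi_0|^{b_2}\hat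 f\|_{L^{a_2}(\mathbb{R}^n)}}{\|\hat f\|_{L^{k_2}(\mathbb{R}^n)}}\right)^{\frac1{a_1}+\frac{b_1}{n}-\frac1{k_1}}\ge C,$$ where the left side is $+\infty$ if a numerator is infinite. Here $f$ and $\hat f$ are both understood to be functions whose products with Schwartz functions are integrable, and $\hat f$ is the Fourier transform of $f$ in the sense of tempered distributions; if $k_1<1$ and $k_2<1$ (when $L^{k_i}$ functions need not be tempered distributions), it is moreover understood that $f$ or $\hat f$ lies in $L^p(\mathbb{R}^n)$ for some $p\in[1,\infty]$. -/

import Mathlib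

open MeasureTheory
open scoped ENNReal SchwartzMap

noncomputable section

/-- The Fourier integral `φ̂(ξ) = ∫ e^{-i x·ξ} φ(x) dx` on `ℝⁿ` (no `2π` in the phase). -/
def fourierInt {n : ℕ} (φ : EuclideanSpace ℝ (Fin n) → ℂ) (ξ : EuclideanSpace ℝ (Fin n)) : ℂ :=
  ∫ x, Complex.exp (-(Complex.I * ((inner ℝ x ξ : ℝ) : ℂ))) * φ x

/-- The function `g` on `ℝⁿ` is the Fourier transform of the function `f`, in the sense of
tempered distributions: `f` and `g` are integrable against all Schwartz functions and
`∫ f φ̂ = ∫ g φ` for every Schwartz function `φ`.  At least one of `f` and `g` is required to lie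
in a Lebesgue space `L^p` with `1 ≤ p ≤ ∞`, so that either `f̂` (and `f̂ = g`) or the inverse
transform of `g` (and `f = 𝓕⁻¹ g`) is the transform of an `L^p` function. -/
def IsFourierPair {n : ℕ} (f g : EuclideanSpace ℝ (Fin n) → ℂ) : Prop :=
  (∃ p : ℝ≥0∞, 1 ≤ p ∧ (MemLp f p volume ∨ MemLp g p volume)) ∧
  ∀ φ : 𝓢(EuclideanSpace ℝ (Fin n), ℂ),
    Integrable (fun x => f x * φ x) volume ∧
    Integrable (fun x => g x * φ x) volume ∧
    ∫ x, f x * fourierInt φ x = ∫ ξ, g ξ * φ ξ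

/-- The exponent `n / (a⁻¹ n + b)`. -/
def critExp (n : ℕ) (a : ℝ≥0∞) (b : ℝ) : ℝ≥0∞ :=
  (n : ℝ≥0∞) / (a⁻¹ * (n : ℝ≥0∞) + ENNReal.ofReal b)

/-- The ratio `‖ |x - x₀|^b f ‖_{L^a} / ‖f‖_{L^k}`. -/
def momentRatio {n : ℕ} (a : ℝ≥0∞) (b : ℝ) (k : ℝ≥0∞) (x₀ : EuclideanSpace ℝ (Fin n))
    (f : EuclideanSpace ℝ (Fin n) → ℂ) : ℝ≥0∞ :=
  eLpNorm (fun x => ((‖x - x₀‖ ^ b : ℝ) : ℂ) * f x) a volume / eLpNorm f k volume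

/-- The exponent `1/a + b/n - 1/k`. -/
def gapExp (n : ℕ) (a : ℝ≥0∞) (b : ℝ) (k : ℝ≥0∞) : ℝ :=
  a⁻¹.toReal + b / (n : ℝ) - k⁻¹.toReal

end

/-!
The moment `‖ |x - x₀|^b f ‖_{L^a}` enters only through the weak `L^r` norm of `f` that it dominates,
`1 / r = 1 / a + b / n` (`exists_weakBound_of_moment`).  Write `ρᵢ = 1 / rᵢ`, `κᵢ = 1 / kᵢ`, let `A`
and `B` be the weak norms of `f` and `f̂` with exponents `r₁` and `r₂`, and let `a = ‖f‖_{k₁}` and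
`b = ‖f̂‖_{k₂}`.  The quantities `F = (A / a)^{1 / (ρ₁ - κ₁)}` and `G = (B / b)^{1 / (ρ₂ - κ₂)}`
measure the size of the effective supports of `f` and `f̂`, and the theorem says that `F G` is bounded
below (`exists_le_log`, in logarithmic form).

Suppose first `k₁, k₂ ≥ 1`.  The hypotheses on the exponents provide `p = 1 / u` in `[1, 2)` with
`r₁ < p ≤ k₁` and `p' > k₂`, or `p = 1` and `k₂ = ∞` (`exists_admissible_exponent`).  Interpolation
between weak norms (`exists_eLpNorm_le_of_weakBound`) bounds `‖f‖_p` by `F^{u - κ₁} a`, the weak-type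
Hausdorff–Young inequality (`IsFourierDual.weakBound`) passes to the weak `L^{p'}` norm of `f̂`, and
a second interpolation gives `b ≲ G^{κ₂ - 1 + u} F^{u - κ₁} a` (`exists_log_eLpNorm_fourier_le`).
Exchanging the roles of `f` and `f̂`, with an exponent `1 / v`, gives
`a ≲ F^{κ₁ - 1 + v} G^{v - κ₂} b`.  In the product `a` and `b` cancel and `1 ≲ (F G)^{u + v - 1}`
remains, where `u + v > 1` (`exists_le_log_of_le_one`).

An exponent `kᵢ < 1` is replaced by `1`: as soon as one of the two functions lies in some `L^p` with
`p ≥ 1`, the function belonging to such a `kᵢ` turns out to be integrable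
(`IsFourierDual.memLp_min_one`), and raising `kᵢ` to `1` does not increase `F` or `G`, up to a
constant (`exists_log_div_le`).  All this is carried out for Mathlib's Fourier transform, that is,
for `ξ ↦ f̂ (2π ξ)` in place of `f̂`.
-/

/-! ### Weak Lebesgue bounds and interpolation -/

section WeakBounds

variable {α F : Type*} [MeasurableSpace α] {μ : Measure α} [NormedAddCommGroup F]

/-- The weak Lebesgue bound `‖f‖_{L^{1/σ,∞}} ≤ A`, parametrized by the reciprocal `σ` of the
exponent: `t * μ {‖f‖ > t} ^ σ ≤ A` for every `t > 0`.  Levels whose superlevel set is null are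
exempt, so that `σ = 0` gives the essential supremum bound `‖f‖ ≤ A`. -/
def WeakBound (μ : Measure α) (f : α → F) (σ A : ℝ) : Prop :=
  ∀ t : ℝ, 0 < t → μ {x | t < ‖f x‖} ≠ 0 →
    ENNReal.ofReal t * μ {x | t < ‖f x‖} ^ σ ≤ ENNReal.ofReal A

theorem WeakBound.mono {f : α → F} {σ A B : ℝ} (h : WeakBound μ f σ A) (hAB : A ≤ B) :
    WeakBound μ f σ B :=
  fun t ht hm => (h t ht hm).trans (ENNReal.ofReal_le_ofReal hAB)

/-- Chebyshev's inequality. -/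
theorem weakBound_of_eLpNorm_le {f : α → F} (hf : AEStronglyMeasurable f μ) {κ A : ℝ}
    (hκ : 0 ≤ κ) (h : eLpNorm f (ENNReal.ofReal κ)⁻¹ μ ≤ ENNReal.ofReal A) :
    WeakBound μ f κ A := by
  intro t ht hm
  rcases hκ.eq_or_lt with rfl | hκ
  · simp only [ENNReal.ofReal_zero, ENNReal.inv_zero, eLpNorm_exponent_top] at h
    simp only [ENNReal.rpow_zero, mul_one]
    by_contra! hlt
    refine hm (measure_mono_null (fun x (hx : t < ‖f x‖) => ?_)
      (ae_iff.1 (ae_le_eLpNormEssSup (f := f) (μ := μ))))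
    simp only [Set.mem_ofPred_eq, not_le]
    refine (h.trans_lt hlt).trans_le ?_
    rw [← ofReal_norm]
    exact ENNReal.ofReal_le_ofReal hx.le
  · have hp : ((ENNReal.ofReal κ)⁻¹).toReal = κ⁻¹ := by
      rw [ENNReal.toReal_inv, ENNReal.toReal_ofReal hκ.le]
    have hc := mul_meas_ge_le_pow_eLpNorm' μ (p := (ENNReal.ofReal κ)⁻¹) (by simp)
      (by simpa using hκ) hf (ENNReal.ofReal t)
    rw [hp] at hc
    have hsub : {x | t < ‖f x‖} ⊆ {x | ENNReal.ofReal t ≤ ‖f x‖ₑ} := fun x (hx : t < ‖f x‖) => by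
      simp only [Set.mem_ofPred_eq]
      rw [← ofReal_norm]
      exact ENNReal.ofReal_le_ofReal hx.le
    have h1 := (mul_le_mul_right (measure_mono hsub) (ENNReal.ofReal t ^ κ⁻¹)).trans hc
    have h2 := ENNReal.rpow_le_rpow h1 hκ.le
    rw [ENNReal.mul_rpow_of_nonneg _ _ hκ.le, ENNReal.rpow_inv_rpow hκ.ne',
      ENNReal.rpow_inv_rpow hκ.ne'] at h2
    exact h2.trans h

theorem eLpNorm_top_le_of_weakBound {f : α → F} {A : ℝ} (h : WeakBound μ f 0 A) :
    eLpNorm f ∞ μ ≤ ENNReal.ofReal A := by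
  rw [eLpNorm_exponent_top]
  refine eLpNormEssSup_le_of_ae_enorm_bound ?_
  have key : μ {x | max A 0 < ‖f x‖} = 0 := by
    have hU : {x | max A 0 < ‖f x‖} ⊆ ⋃ k : ℕ, {x | max A 0 + 1 / ((k : ℝ) + 1) < ‖f x‖} := by
      intro x (hx : max A 0 < ‖f x‖)
      obtain ⟨k, hk⟩ := exists_nat_one_div_lt (sub_pos.2 hx)
      exact Set.mem_iUnion.2 ⟨k, by simp only [Set.mem_ofPred_eq]; linarith⟩
    refine measure_mono_null hU (measure_iUnion_null fun k => ?_)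
    by_contra hm
    have hk : (0 : ℝ) < 1 / ((k : ℝ) + 1) := by positivity
    have h0 := le_max_right A 0
    have h1 := le_max_left A 0
    have := h _ (by linarith) hm
    rw [ENNReal.rpow_zero, mul_one, ENNReal.ofReal_le_ofReal_iff'] at this
    rcases this with h2 | h2 <;> linarith
  filter_upwards [show ∀ᵐ x ∂μ, ¬ max A 0 < ‖f x‖ by simpa [ae_iff] using key] with x hx
  rw [← ofReal_norm]
  refine (ENNReal.ofReal_le_ofReal (not_lt.1 hx)).trans ?_
  rw [ENNReal.ofReal_max]; simp

/-- Log-convexity of the weak norms. -/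
theorem WeakBound.interpolate {f : α → F} {ρ σ A B θ : ℝ} (hA : WeakBound μ f ρ A)
    (hB : WeakBound μ f σ B) (hA0 : 0 < A) (hB0 : 0 < B) (hρ : 0 ≤ ρ) (hσ : 0 ≤ σ)
    (h0 : 0 ≤ θ) (h1 : θ ≤ 1) :
    WeakBound μ f (θ * ρ + (1 - θ) * σ) (A ^ θ * B ^ (1 - θ)) := by
  intro t ht hm
  have h1' : 0 ≤ 1 - θ := by linarith
  have hmul := mul_le_mul' (ENNReal.rpow_le_rpow (hA t ht hm) h0)
    (ENNReal.rpow_le_rpow (hB t ht hm) h1')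
  rw [ENNReal.ofReal_rpow_of_pos hA0, ENNReal.ofReal_rpow_of_pos hB0,
    ← ENNReal.ofReal_mul (by positivity)] at hmul
  refine le_trans (le_of_eq ?_) hmul
  have ht' : ENNReal.ofReal t ≠ 0 := by simpa using ht
  rw [ENNReal.mul_rpow_of_nonneg _ _ h0, ENNReal.mul_rpow_of_nonneg _ _ h1', mul_mul_mul_comm,
    ← ENNReal.rpow_add _ _ ht' ENNReal.ofReal_ne_top, ← ENNReal.rpow_mul, ← ENNReal.rpow_mul,
    ← ENNReal.rpow_add_of_nonneg _ _ (mul_nonneg hρ h0) (mul_nonneg hσ h1')]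
  simp only [add_sub_cancel, ENNReal.rpow_one]
  congr 2; ring

theorem WeakBound.measure_le {f : α → F} {σ A : ℝ} (h : WeakBound μ f σ A) (hσ : 0 < σ)
    (hA : 0 < A) {t : ℝ} (ht : 0 < t) :
    μ {x | t < ‖f x‖} ≤ ENNReal.ofReal ((A / t) ^ σ⁻¹) := by
  by_cases hm : μ {x | t < ‖f x‖} = 0
  · simp [hm]
  have h1 := h t ht hm
  have h2 : μ {x | t < ‖f x‖} ^ σ ≤ ENNReal.ofReal (A / t) := by
    rw [ENNReal.ofReal_div_of_pos ht, ENNReal.le_div_iff_mul_le (by simp [ht]) (by simp), mul_comm]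
    exact h1
  have h3 := ENNReal.rpow_le_rpow h2 (inv_nonneg.2 hσ.le)
  rwa [ENNReal.rpow_rpow_inv hσ.ne', ENNReal.ofReal_rpow_of_pos (by positivity)] at h3

/-- Integrating the distribution function, split at the height `T`. -/
theorem lintegral_rpow_norm_le {f : α → F} (hf : AEStronglyMeasurable f μ) {r q s A B T : ℝ}
    (hr : 0 < r) (hrq : r < q) (hqs : q < s) (hA0 : 0 < A) (hB0 : 0 < B) (hT : 0 < T)
    (hA : WeakBound μ f r⁻¹ A) (hB : WeakBound μ f s⁻¹ B) :
    ∫⁻ x, ENNReal.ofReal (‖f x‖ ^ q) ∂μ ≤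
      ENNReal.ofReal (q * (A ^ r * T ^ (q - r) / (q - r) + B ^ s * T ^ (q - s) / (s - q))) := by
  have hq : 0 < q := hr.trans hrq
  have hs : 0 < s := hq.trans hqs
  rw [lintegral_rpow_eq_lintegral_meas_lt_mul μ (Filter.Eventually.of_forall fun x => norm_nonneg _)
    hf.norm.aemeasurable hq, ENNReal.ofReal_mul hq.le]
  refine mul_le_mul_right ?_ _
  have hsplit : Set.Ioi (0 : ℝ) = Set.Ioc 0 T ∪ Set.Ioi T := (Set.Ioc_union_Ioi_eq_Ioi hT.le).symm
  have hq_r : 0 < q - r := by linarith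
  have hs_q : 0 < s - q := by linarith
  rw [hsplit, ENNReal.ofReal_add (by positivity) (by positivity)]
  refine (lintegral_union_le _ _ _).trans (add_le_add ?_ ?_)
  · have hint : IntegrableOn (fun t : ℝ => A ^ r * t ^ (q - r - 1)) (Set.Ioc 0 T) :=
      ((intervalIntegrable_iff_integrableOn_Ioc_of_le hT.le).1
        (intervalIntegral.intervalIntegrable_rpow' (by linarith))).const_mul _
    have hval : ∫ t in Set.Ioc 0 T, A ^ r * t ^ (q - r - 1) = A ^ r * T ^ (q - r) / (q - r) := by
      rw [integral_const_mul, ← intervalIntegral.integral_of_le hT.le,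
        integral_rpow (Or.inl (by linarith)), sub_add_cancel, Real.zero_rpow hq_r.ne', sub_zero,
        mul_div_assoc]
    rw [← hval, ofReal_integral_eq_lintegral_ofReal hint
      ((ae_restrict_iff' measurableSet_Ioc).2 (Filter.Eventually.of_forall fun t ht => by
        have := ht.1; positivity))]
    refine setLIntegral_mono' measurableSet_Ioc fun t ht => ?_
    have ht0 : 0 < t := ht.1
    refine (mul_le_mul_left (hA.measure_le (by positivity) hA0 ht0) _).trans (le_of_eq ?_)
    rw [← ENNReal.ofReal_mul (by positivity), inv_inv, Real.div_rpow hA0.le ht0.le,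
      show q - r - 1 = (q - 1) - r by ring, Real.rpow_sub ht0 (q - 1) r]
    congr 1; ring
  · have hint : IntegrableOn (fun t : ℝ => B ^ s * t ^ (q - s - 1)) (Set.Ioi T) :=
      (integrableOn_Ioi_rpow_of_lt (by linarith) hT).const_mul _
    have hval : ∫ t in Set.Ioi T, B ^ s * t ^ (q - s - 1) = B ^ s * T ^ (q - s) / (s - q) := by
      rw [integral_const_mul, integral_Ioi_rpow_of_lt (by linarith) hT, sub_add_cancel,
        show s - q = -(q - s) by ring, div_neg, mul_div_assoc, neg_div, mul_neg]
    rw [← hval, ofReal_integral_eq_lintegral_ofReal hint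
      ((ae_restrict_iff' measurableSet_Ioi).2 (Filter.Eventually.of_forall fun t ht => by
        have := hT.trans ht; positivity))]
    refine setLIntegral_mono' measurableSet_Ioi fun t ht => ?_
    have ht0 : 0 < t := hT.trans ht
    refine (mul_le_mul_left (hB.measure_le (by positivity) hB0 ht0) _).trans (le_of_eq ?_)
    rw [← ENNReal.ofReal_mul (by positivity), inv_inv, Real.div_rpow hB0.le ht0.le,
      show q - s - 1 = (q - 1) - s by ring, Real.rpow_sub ht0 (q - 1) s]
    congr 1; ring

/-- The case of a positive lower exponent `σ`; the layer cake integral is optimized over the height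
at which the two bounds on the distribution function are exchanged. -/
theorem exists_eLpNorm_le_of_weakBound_of_pos {σ κ ρ : ℝ} (hσ : 0 < σ) (hσκ : σ < κ)
    (hκρ : κ < ρ) :
    ∃ C : ℝ, 0 < C ∧ ∀ (f : α → F), AEStronglyMeasurable f μ → ∀ A B : ℝ, 0 < A → 0 < B →
      WeakBound μ f ρ A → WeakBound μ f σ B →
      eLpNorm f (ENNReal.ofReal κ)⁻¹ μ ≤
        ENNReal.ofReal (C * (A ^ ((κ - σ) / (ρ - σ)) * B ^ (1 - (κ - σ) / (ρ - σ)))) := by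
  have hκ : 0 < κ := hσ.trans hσκ
  have hρ : 0 < ρ := hκ.trans hκρ
  have hrq : ρ⁻¹ < κ⁻¹ := (inv_lt_inv₀ hρ hκ).2 hκρ
  have hqs : κ⁻¹ < σ⁻¹ := (inv_lt_inv₀ hκ hσ).2 hσκ
  have hq_r : 0 < κ⁻¹ - ρ⁻¹ := by linarith
  have hs_q : 0 < σ⁻¹ - κ⁻¹ := by linarith
  have hs_r : 0 < σ⁻¹ - ρ⁻¹ := by linarith
  have hρσ : 0 < ρ - σ := by linarith
  refine ⟨(κ⁻¹ * (1 / (κ⁻¹ - ρ⁻¹) + 1 / (σ⁻¹ - κ⁻¹))) ^ κ, by positivity, ?_⟩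
  intro f hf A B hA0 hB0 hA hB
  -- the height at which the two bounds on the distribution function agree
  set T : ℝ := Real.exp ((σ⁻¹ * Real.log B - ρ⁻¹ * Real.log A) / (σ⁻¹ - ρ⁻¹)) with hTdef
  have hT : 0 < T := Real.exp_pos _
  have hlogT : Real.log T = (σ⁻¹ * Real.log B - ρ⁻¹ * Real.log A) / (σ⁻¹ - ρ⁻¹) := Real.log_exp _
  have hmain := lintegral_rpow_norm_le hf (inv_pos.2 hρ) hrq hqs hA0 hB0 hT (by rwa [inv_inv])
    (by rwa [inv_inv])
  set X : ℝ := A ^ ((κ - σ) / (ρ - σ)) * B ^ (1 - (κ - σ) / (ρ - σ)) with hX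
  have hX0 : 0 < X := by positivity
  have hXlog : Real.log X = (κ - σ) / (ρ - σ) * Real.log A +
      (1 - (κ - σ) / (ρ - σ)) * Real.log B := by
    rw [hX, Real.log_mul (by positivity) (by positivity), Real.log_rpow hA0, Real.log_rpow hB0]
  have e1 : A ^ ρ⁻¹ * T ^ (κ⁻¹ - ρ⁻¹) = X ^ κ⁻¹ := by
    refine Real.log_injOn_pos (Set.mem_Ioi.2 (by positivity)) (Set.mem_Ioi.2 (by positivity)) ?_
    rw [Real.log_mul (by positivity) (by positivity), Real.log_rpow hA0, Real.log_rpow hT,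
      Real.log_rpow hX0, hXlog, hlogT]
    field_simp
    ring
  have e2 : B ^ σ⁻¹ * T ^ (κ⁻¹ - σ⁻¹) = X ^ κ⁻¹ := by
    refine Real.log_injOn_pos (Set.mem_Ioi.2 (by positivity)) (Set.mem_Ioi.2 (by positivity)) ?_
    rw [Real.log_mul (by positivity) (by positivity), Real.log_rpow hB0, Real.log_rpow hT,
      Real.log_rpow hX0, hXlog, hlogT]
    field_simp
    ring
  rw [e1, e2] at hmain
  have hp : ((ENNReal.ofReal κ)⁻¹).toReal = κ⁻¹ := by
    rw [ENNReal.toReal_inv, ENNReal.toReal_ofReal hκ.le]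
  rw [eLpNorm_eq_lintegral_rpow_enorm_toReal (by simp) (by simpa using hκ), hp, one_div, inv_inv]
  have hnorm : ∀ x, ‖f x‖ₑ ^ κ⁻¹ = ENNReal.ofReal (‖f x‖ ^ κ⁻¹) := fun x => by
    rw [← ofReal_norm, ENNReal.ofReal_rpow_of_nonneg (norm_nonneg _) (by positivity)]
  simp only [hnorm]
  refine (ENNReal.rpow_le_rpow hmain hκ.le).trans (le_of_eq ?_)
  rw [ENNReal.ofReal_rpow_of_nonneg (by positivity) hκ.le]
  congr 1
  rw [show κ⁻¹ * (X ^ κ⁻¹ / (κ⁻¹ - ρ⁻¹) + X ^ κ⁻¹ / (σ⁻¹ - κ⁻¹)) =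
      (κ⁻¹ * (1 / (κ⁻¹ - ρ⁻¹) + 1 / (σ⁻¹ - κ⁻¹))) * X ^ κ⁻¹ by ring,
    Real.mul_rpow (by positivity) (by positivity), Real.rpow_inv_rpow hX0.le hκ.ne']

/-- Interpolation between two weak Lebesgue bounds: a strong bound holds at every exponent
strictly between the two, and also at the endpoint `L^∞`. -/
theorem exists_eLpNorm_le_of_weakBound {σ κ ρ : ℝ} (hσ : 0 ≤ σ) (hσκ : σ < κ ∨ κ = 0 ∧ σ = 0)
    (hκρ : κ < ρ) :
    ∃ C : ℝ, 0 < C ∧ ∀ (f : α → F), AEStronglyMeasurable f μ → ∀ A B : ℝ, 0 < A → 0 < B →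
      WeakBound μ f ρ A → WeakBound μ f σ B →
      eLpNorm f (ENNReal.ofReal κ)⁻¹ μ ≤
        ENNReal.ofReal (C * (A ^ ((κ - σ) / (ρ - σ)) * B ^ (1 - (κ - σ) / (ρ - σ)))) := by
  rcases hσκ with hσκ | ⟨rfl, rfl⟩
  swap
  · refine ⟨1, one_pos, fun f _ A B _ _ _ hB => ?_⟩
    simpa using eLpNorm_top_le_of_weakBound hB
  have hρσ : 0 < ρ - σ := by linarith
  -- a weak bound at the positive exponent `(σ + κ) / 2` lies between the two given ones
  obtain ⟨C, hC, h⟩ := exists_eLpNorm_le_of_weakBound_of_pos (μ := μ) (F := F)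
    (σ := (σ + κ) / 2) (by linarith) (by linarith) hκρ
  refine ⟨C, hC, fun f hf A B hA0 hB0 hA hB => ?_⟩
  set θ : ℝ := ((σ + κ) / 2 - σ) / (ρ - σ) with hθ
  have hw := hA.interpolate hB hA0 hB0 (by linarith) hσ (θ := θ)
    (div_nonneg (by linarith) hρσ.le) ((div_le_one hρσ).2 (by linarith))
  rw [show θ * ρ + (1 - θ) * σ = (σ + κ) / 2 by rw [hθ]; field_simp; ring] at hw
  refine (h f hf A _ hA0 (by positivity) hA hw).trans (le_of_eq ?_)
  congr 2
  have hY : 0 < A ^ θ * B ^ (1 - θ) := by positivity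
  have hθ' : (κ - (σ + κ) / 2) / (ρ - (σ + κ) / 2) +
      θ * (1 - (κ - (σ + κ) / 2) / (ρ - (σ + κ) / 2)) = (κ - σ) / (ρ - σ) := by
    have hd : ρ - (σ + κ) / 2 ≠ 0 := by linarith
    rw [hθ]
    generalize hτ : (σ + κ) / 2 = τ at hd ⊢
    obtain rfl : κ = 2 * τ - σ := by linarith
    field_simp
    ring
  refine Real.log_injOn_pos (Set.mem_Ioi.2 (by positivity)) (Set.mem_Ioi.2 (by positivity)) ?_
  rw [Real.log_mul (by positivity) (Real.rpow_pos_of_pos hY _).ne', Real.log_rpow hY,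
    Real.log_mul (by positivity) (by positivity), Real.log_mul (by positivity) (by positivity),
    ← hθ']
  simp only [Real.log_rpow hA0, Real.log_rpow hB0]
  ring

end WeakBounds

/-! ### A moment bound is a weak Lebesgue bound -/

/-- A weighted bound `‖ |x - x₀|^b f ‖_{L^a} ≤ A` controls the weak `L^r` norm of `f`,
`1 / r = 1 / a + b / n`: at least half of each superlevel set `{‖f‖ > t}` lies outside the ball
around `x₀` whose volume is half that of the set, and there the weight is bounded below. -/
theorem exists_weakBound_of_moment {n : ℕ} (hn : 0 < n) {a : ℝ≥0∞} {b : ℝ} (ha : 0 < a)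
    (hb : 0 < b) :
    ∃ C : ℝ, 0 < C ∧ ∀ (f : EuclideanSpace ℝ (Fin n) → ℂ), AEStronglyMeasurable f volume →
      ∀ (x₀ : EuclideanSpace ℝ (Fin n)) (A : ℝ), 0 < A →
      eLpNorm (fun x => ((‖x - x₀‖ ^ b : ℝ) : ℂ) * f x) a volume ≤ ENNReal.ofReal A →
      WeakBound volume f (a⁻¹.toReal + b / n) (C * A) := by
  have : Nonempty (Fin n) := ⟨⟨0, hn⟩⟩
  set α : ℝ := a⁻¹.toReal with hα
  have hα0 : 0 ≤ α := ENNReal.toReal_nonneg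
  have hn' : (0 : ℝ) < n := by exact_mod_cast hn
  have hρ : 0 < α + b / n := by positivity
  -- the volume of the unit ball
  set ω : ℝ := (volume (Metric.ball (0 : EuclideanSpace ℝ (Fin n)) 1)).toReal with hω
  have hω0 : 0 < ω := ENNReal.toReal_pos (Metric.measure_ball_pos _ _ one_pos).ne'
    measure_ball_lt_top.ne
  have hball : ∀ (x₀ : EuclideanSpace ℝ (Fin n)) (R : ℝ), 0 ≤ R →
      volume (Metric.ball x₀ R) = ENNReal.ofReal (R ^ n * ω) := fun x₀ R hR => by
    rw [Measure.addHaar_ball volume x₀ hR, finrank_euclideanSpace_fin,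
      ENNReal.ofReal_mul (by positivity), hω, ENNReal.ofReal_toReal measure_ball_lt_top.ne]
  set C : ℝ := 2 ^ α * (2 * ω) ^ (b / n) with hC
  have hC0 : 0 < C := by positivity
  refine ⟨C, hC0, fun f hf x₀ A hA h t ht hm => ?_⟩
  set E : Set (EuclideanSpace ℝ (Fin n)) := {x | t < ‖f x‖} with hE
  have hmeas : AEStronglyMeasurable (fun x => ((‖x - x₀‖ ^ b : ℝ) : ℂ) * f x) volume := by
    refine AEStronglyMeasurable.mul (Continuous.aestronglyMeasurable ?_) hf
    exact Complex.continuous_ofReal.comp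
      ((continuous_id.sub continuous_const).norm.rpow_const fun _ => Or.inr hb.le)
  have hp : a = (ENNReal.ofReal α)⁻¹ := by
    rw [hα, ENNReal.ofReal_toReal (by simpa using ha.ne'), inv_inv]
  have hw : WeakBound volume (fun x => ((‖x - x₀‖ ^ b : ℝ) : ℂ) * f x) α A :=
    weakBound_of_eLpNorm_le hmeas hα0 (by rwa [← hp])
  have key : ∀ m : ℝ, 0 < m → ENNReal.ofReal m ≤ volume E → t * m ^ (α + b / n) ≤ C * A := by
    intro m hm0 hmE
    set R : ℝ := (m / (2 * ω)) ^ ((n : ℝ)⁻¹) with hR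
    have hR0 : 0 < R := by positivity
    have hRn : R ^ n * ω = m / 2 := by
      rw [hR, ← Real.rpow_natCast, Real.rpow_inv_rpow (by positivity) hn'.ne']
      field_simp
    have hRb : R ^ b = (m / (2 * ω)) ^ (b / n) := by
      rw [hR, ← Real.rpow_mul (by positivity)]; congr 1; field_simp
    have hdiff : ENNReal.ofReal (m / 2) ≤ volume (E \ Metric.ball x₀ R) := by
      have h1 : ENNReal.ofReal (m / 2) + ENNReal.ofReal (m / 2) ≤
          volume (E \ Metric.ball x₀ R) + ENNReal.ofReal (m / 2) := by
        rw [← ENNReal.ofReal_add (by positivity) (by positivity), add_halves]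
        refine hmE.trans ?_
        conv_rhs => rw [← hRn, ← hball x₀ R hR0.le]
        exact (measure_mono (by rw [Set.sdiff_union_self]; exact Set.subset_union_left)).trans
          (measure_union_le _ _)
      exact (ENNReal.add_le_add_iff_right ENNReal.ofReal_ne_top).1 h1
    have hsub : E \ Metric.ball x₀ R ⊆
        {x | R ^ b * t < ‖((‖x - x₀‖ ^ b : ℝ) : ℂ) * f x‖} := by
      rintro x ⟨hx, hxb⟩
      have hx1 : t < ‖f x‖ := hx
      have hx2 : R ≤ ‖x - x₀‖ := by simpa [dist_eq_norm] using hxb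
      have hx3 : R ^ b ≤ ‖x - x₀‖ ^ b := Real.rpow_le_rpow hR0.le hx2 hb.le
      have hx4 : 0 < R ^ b := by positivity
      simp only [Set.mem_ofPred_eq, norm_mul, Complex.norm_real, Real.norm_eq_abs]
      rw [abs_of_nonneg (by positivity)]
      nlinarith
    have hle := hdiff.trans (measure_mono hsub)
    have hpos : 0 < ENNReal.ofReal (m / 2) := by simpa using hm0
    have h2 := hw (R ^ b * t) (by positivity) (hpos.trans_le hle).ne'
    have h3 := (mul_le_mul_right (ENNReal.rpow_le_rpow hle hα0) _).trans h2
    rw [ENNReal.ofReal_rpow_of_pos (by positivity), ← ENNReal.ofReal_mul (by positivity),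
      ENNReal.ofReal_le_ofReal_iff hA.le] at h3
    have e : t * m ^ (α + b / n) = C * (R ^ b * t * (m / 2) ^ α) := by
      rw [hRb, hC, Real.rpow_add hm0, Real.div_rpow hm0.le (by positivity),
        Real.div_rpow hm0.le (by positivity)]
      have := (Real.rpow_pos_of_pos (show (0:ℝ) < 2 * ω by positivity) (b / n)).ne'
      have := (Real.rpow_pos_of_pos (show (0:ℝ) < 2 by positivity) α).ne'
      field_simp
    rw [e]
    exact mul_le_mul_of_nonneg_left h3 hC0.le
  have hfin : volume E ≠ ∞ := by
    intro htop
    set m : ℝ := ((C * A + 1) / t) ^ (α + b / n)⁻¹ with hmdef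
    have := key m (by positivity) (by rw [htop]; exact le_top)
    rw [hmdef, Real.rpow_inv_rpow (by positivity) hρ.ne', mul_div_cancel₀ _ ht.ne'] at this
    linarith
  have h5 := key (volume E).toReal (ENNReal.toReal_pos hm hfin) ENNReal.ofReal_toReal_le
  rw [← ENNReal.ofReal_toReal hfin, ENNReal.ofReal_rpow_of_pos (ENNReal.toReal_pos hm hfin),
    ← ENNReal.ofReal_mul ht.le]
  exact ENNReal.ofReal_le_ofReal h5

/-! ### Fourier transforms in the sense of tempered distributions -/

section Duality

open FourierTransform SchwartzMap
open scoped ContDiff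

variable {V : Type*} [NormedAddCommGroup V] [InnerProductSpace ℝ V] [FiniteDimensional ℝ V]
  [MeasurableSpace V] [BorelSpace V]

theorem locallyIntegrable_of_integrable_mul_schwartz {f : V → ℂ}
    (h : ∀ φ : 𝓢(V, ℂ), Integrable (fun x => f x * φ x)) : LocallyIntegrable f := by
  rw [locallyIntegrable_iff]
  intro K hK
  obtain ⟨R, hR0, hR⟩ := hK.isBounded.subset_closedBall_lt 0 (0 : V)
  let χ : ContDiffBump (0 : V) := ⟨R, R + 1, hR0, by linarith⟩
  have hc : HasCompactSupport (fun x => (χ x : ℂ)) :=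
    χ.hasCompactSupport.comp_left (g := fun r : ℝ => (r : ℂ)) rfl
  have hs : ContDiff ℝ ∞ (fun x => (χ x : ℂ)) := Complex.ofRealCLM.contDiff.comp χ.contDiff
  refine ((h (hc.toSchwartzMap hs)).integrableOn (s := K)).congr_fun (fun x hx => ?_)
    hK.measurableSet
  have : χ x = 1 := χ.one_of_mem_closedBall (hR hx)
  simp [HasCompactSupport.toSchwartzMap_toFun, this]

theorem ae_eq_of_integral_mul_schwartz_eq {f g : V → ℂ} (hf : LocallyIntegrable f)
    (hg : LocallyIntegrable g) (h : ∀ φ : 𝓢(V, ℂ), ∫ x, f x * φ x = ∫ x, g x * φ x) :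
    f =ᵐ[volume] g := by
  refine ae_eq_of_integral_contDiff_smul_eq hf hg fun χ hχ hχc => ?_
  have hc : HasCompactSupport (fun x => (χ x : ℂ)) :=
    hχc.comp_left (g := fun r : ℝ => (r : ℂ)) rfl
  have hs : ContDiff ℝ ∞ (fun x => (χ x : ℂ)) := Complex.ofRealCLM.contDiff.comp hχ
  simpa [HasCompactSupport.toSchwartzMap_toFun, mul_comm] using h (hc.toSchwartzMap hs)

/-- `G` is the Fourier transform of `f` as a tempered distribution, in Mathlib's normalization
`𝓕 φ ξ = ∫ exp (-2πi x·ξ) φ x`. -/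
def IsFourierDual (f G : V → ℂ) : Prop :=
  ∀ φ : 𝓢(V, ℂ), Integrable (fun x => f x * φ x) ∧ Integrable (fun x => G x * φ x) ∧
    ∫ x, f x * 𝓕 φ x = ∫ x, G x * φ x

theorem IsFourierDual.locallyIntegrable_left {f G : V → ℂ} (h : IsFourierDual f G) :
    LocallyIntegrable f :=
  locallyIntegrable_of_integrable_mul_schwartz fun φ => (h φ).1

theorem IsFourierDual.locallyIntegrable_right {f G : V → ℂ} (h : IsFourierDual f G) :
    LocallyIntegrable G :=
  locallyIntegrable_of_integrable_mul_schwartz fun φ => (h φ).2.1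

/-- Fourier inversion: `f (-x)` is the Fourier transform of `G`. -/
theorem IsFourierDual.symm {f G : V → ℂ} (h : IsFourierDual f G) :
    IsFourierDual G (fun x => f (-x)) := by
  intro φ
  have hφ : ∀ x, 𝓕 (𝓕 φ) x = φ (-x) := fun x => by
    have h1 : 𝓕⁻ (𝓕 φ) (-x) = φ (-x) := by rw [fourierInv_fourier_eq]
    rw [SchwartzMap.fourierInv_coe, Real.fourierInv_eq_fourier_neg, neg_neg] at h1
    rw [← h1, SchwartzMap.fourier_coe]
  have hint : Integrable (fun x => f (-x) * φ x) := by
    have := ((h (𝓕 (𝓕 φ))).1).comp_neg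
    simpa [hφ] using this
  refine ⟨(h φ).2.1, hint, ?_⟩
  rw [← (h (𝓕 φ)).2.2, ← integral_neg_eq_self]
  simp [hφ]

theorem IsFourierDual.ae_eq_zero {f G : V → ℂ} (h : IsFourierDual f G) (hG : G =ᵐ[volume] 0) :
    f =ᵐ[volume] 0 := by
  have h0 : (fun x => f (-x)) =ᵐ[volume] 0 := by
    refine ae_eq_of_integral_mul_schwartz_eq h.symm.locallyIntegrable_right
      (locallyIntegrable_const 0) fun φ => ?_
    rw [← (h.symm φ).2.2]
    refine integral_congr_ae ?_
    filter_upwards [hG] with x hx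
    simp [hx]
  have := (Measure.measurePreserving_neg (volume : Measure V)).quasiMeasurePreserving.ae h0
  filter_upwards [this] with x hx
  simpa using hx

theorem integral_mul_fourier_of_integrable {f : V → ℂ} (hf : Integrable f) (φ : 𝓢(V, ℂ)) :
    ∫ x, f x * 𝓕 φ x = ∫ x, 𝓕 f x * φ x := by
  have := VectorFourier.integral_fourierIntegral_smul_eq_flip (L := innerₗ V)
    (μ := volume) (ν := volume) Real.continuous_fourierChar continuous_inner hf φ.integrable
  simp only [smul_eq_mul, flip_innerₗ] at this
  exact this.symm

theorem continuous_fourier {f : V → ℂ} (hf : Integrable f) : Continuous (𝓕 f) :=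
  VectorFourier.fourierIntegral_continuous Real.continuous_fourierChar
    (L := innerₗ V) continuous_inner hf

theorem norm_fourier_le {f : V → ℂ} (ξ : V) : ‖𝓕 f ξ‖ ≤ ∫ x, ‖f x‖ :=
  VectorFourier.norm_fourierIntegral_le_integral_norm _ _ _ _ _

/-- Plancherel's theorem, tested against Schwartz functions. -/
theorem exists_integral_mul_fourier_of_memLp_two {f : V → ℂ} (hf : MemLp f 2) :
    ∃ g : V → ℂ, MemLp g 2 ∧ eLpNorm g 2 volume = eLpNorm f 2 volume ∧
      ∀ φ : 𝓢(V, ℂ), ∫ x, f x * 𝓕 φ x = ∫ x, g x * φ x := by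
  refine ⟨(𝓕 (hf.toLp f) : Lp ℂ 2 (volume : Measure V)), Lp.memLp _, ?_, fun φ => ?_⟩
  · have h1 := Lp.norm_fourier_eq (hf.toLp f)
    rw [Lp.norm_def, Lp.norm_toLp] at h1
    exact (ENNReal.toReal_eq_toReal_iff' (Lp.eLpNorm_ne_top _) hf.2.ne).1 h1
  · have h1 := congrArg (fun T : 𝓢'(V, ℂ) => T φ)
      (Lp.fourier_toTemperedDistribution_eq (hf.toLp f))
    simp only [TemperedDistribution.fourier_apply, Lp.toTemperedDistribution_apply,
      smul_eq_mul] at h1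
    simp only [mul_comm _ (φ _)]
    rw [← h1]
    refine integral_congr_ae ?_
    filter_upwards [hf.coeFn_toLp] with x hx
    rw [hx, mul_comm]

theorem IsFourierDual.ae_eq_fourier {f G : V → ℂ} (h : IsFourierDual f G) (hf : Integrable f) :
    G =ᵐ[volume] 𝓕 f :=
  ae_eq_of_integral_mul_schwartz_eq h.locallyIntegrable_right
    (continuous_fourier hf).locallyIntegrable
    fun φ => by rw [← (h φ).2.2, integral_mul_fourier_of_integrable hf]

/-- The transform of an integrable function is bounded by its `L¹` norm. -/
theorem IsFourierDual.weakBound_zero {f G : V → ℂ} (h : IsFourierDual f G) (hf : Integrable f) :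
    WeakBound volume G 0 (∫ x, ‖f x‖) := by
  refine weakBound_of_eLpNorm_le h.locallyIntegrable_right.aestronglyMeasurable le_rfl ?_
  simp only [ENNReal.ofReal_zero, ENNReal.inv_zero, eLpNorm_exponent_top]
  refine eLpNormEssSup_le_of_ae_bound ?_
  filter_upwards [h.ae_eq_fourier hf] with x hx
  rw [hx]
  exact norm_fourier_le x

/-- If `f = f₁ + f₂` with `‖f₁‖_1 ≤ t / 2`, then the superlevel set `{‖G‖ > t}` only sees `f₂`,
whose transform is controlled by Plancherel's theorem. -/
theorem IsFourierDual.measure_lt_le {f G f₁ f₂ : V → ℂ} (h : IsFourierDual f G)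
    (hf₁ : Integrable f₁) (hf₂ : MemLp f₂ 2) (hadd : ∀ x, f x = f₁ x + f₂ x) {t : ℝ}
    (ht : 0 < t) (h₁ : ∫ x, ‖f₁ x‖ ≤ t / 2) :
    volume {x | t < ‖G x‖} ≤ ENNReal.ofReal ((t / 2) ^ 2)⁻¹ * eLpNorm f₂ 2 volume ^ 2 := by
  obtain ⟨g₂, hg₂, hnorm, hint⟩ := exists_integral_mul_fourier_of_memLp_two hf₂
  have hg₂loc : LocallyIntegrable g₂ := hg₂.locallyIntegrable one_le_two
  have hg₁loc : LocallyIntegrable (𝓕 f₁) := (continuous_fourier hf₁).locallyIntegrable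
  have hae : G =ᵐ[volume] fun x => 𝓕 f₁ x + g₂ x := by
    refine ae_eq_of_integral_mul_schwartz_eq h.locallyIntegrable_right
      (hg₁loc.add hg₂loc) fun φ => ?_
    have hb : Integrable (fun x => 𝓕 f₁ x * φ x) :=
      φ.integrable.bdd_mul (continuous_fourier hf₁).aestronglyMeasurable
        (Filter.Eventually.of_forall fun x => norm_fourier_le x)
    have hb' : Integrable (fun x => f₁ x * 𝓕 φ x) := by
      exact hf₁.mul_bdd (𝓕 φ).continuous.aestronglyMeasurable
        (Filter.Eventually.of_forall (𝓕 φ).toBoundedContinuousFunction.norm_coe_le_norm)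
    have h2 : ∀ {k : V → ℂ}, MemLp k 2 → ∀ ψ : 𝓢(V, ℂ), Integrable (fun x => k x * ψ x) :=
      fun hk ψ => hk.integrable_mul (ψ.memLp 2)
    rw [← (h φ).2.2]
    simp only [hadd, add_mul]
    rw [integral_add hb' (h2 hf₂ _), integral_add hb (h2 hg₂ _),
      integral_mul_fourier_of_integrable hf₁, hint]
  have hsub : volume {x | t < ‖G x‖} ≤ volume {x | ENNReal.ofReal (t / 2) ≤ ‖g₂ x‖ₑ} := by
    refine measure_mono_ae ?_
    filter_upwards [hae] with x hx hxt
    have hxt : t < ‖G x‖ := hxt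
    have h3 := norm_add_le (𝓕 f₁ x) (g₂ x)
    have h4 := norm_fourier_le (f := f₁) x
    rw [hx] at hxt
    change ENNReal.ofReal (t / 2) ≤ ‖g₂ x‖ₑ
    rw [← ofReal_norm]
    exact ENNReal.ofReal_le_ofReal (by linarith)
  have hc := mul_meas_ge_le_pow_eLpNorm' volume (p := 2) (by simp) (by simp)
    hg₂.aestronglyMeasurable (ENNReal.ofReal (t / 2))
  rw [hnorm] at hc
  simp only [ENNReal.toReal_ofNat, ENNReal.rpow_ofNat] at hc
  refine hsub.trans ?_
  rw [ENNReal.ofReal_inv_of_pos (by positivity), ENNReal.ofReal_pow (by positivity), mul_comm,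
    ← div_eq_mul_inv, ENNReal.le_div_iff_mul_le (by simp [ht]) (by simp), mul_comm]
  exact hc

/-- The weak-type Hausdorff–Young inequality for exponents `1 < p < 2`, by cutting `f` at the
height `s` where the `L¹` norm of the large part is `t / 2`. -/
theorem IsFourierDual.weakBound_of_lt_one {f G : V → ℂ} (h : IsFourierDual f G) {u D : ℝ}
    (hu : 1 / 2 < u) (hu1 : u < 1) (hD : 0 < D)
    (hf : eLpNorm f (ENNReal.ofReal u)⁻¹ volume ≤ ENNReal.ofReal D) :
    WeakBound volume G (1 - u) (2 * D) := by
  intro t ht _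
  have hu0 : 0 < u := by linarith
  have hfm : AEStronglyMeasurable f volume := h.locallyIntegrable_left.aestronglyMeasurable
  obtain ⟨p, hp⟩ : ∃ p, p = u⁻¹ := ⟨_, rfl⟩
  have hup : u = p⁻¹ := by rw [hp, inv_inv]
  have hp1 : 1 < p := by rw [hp]; exact (one_lt_inv₀ hu0).2 hu1
  have hp2 : p < 2 := by rw [hp]; exact (inv_lt_comm₀ hu0 two_pos).2 (by linarith)
  have hp0 : 0 < p := by linarith
  -- `s ^ (1 - p) * D ^ p` bounds `‖f₁‖_1`, and `s ^ (2 - p) * D ^ p` bounds `‖f₂‖_2 ^ 2`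
  have hI : ∫⁻ x, ENNReal.ofReal (‖f x‖ ^ p) ≤ ENNReal.ofReal (D ^ p) := by
    have hpr : ((ENNReal.ofReal u)⁻¹).toReal = p := by
      rw [ENNReal.toReal_inv, ENNReal.toReal_ofReal hu0.le, hp]
    rw [eLpNorm_eq_lintegral_rpow_enorm_toReal (by simp) (by simpa using hu0), hpr, one_div] at hf
    have := ENNReal.rpow_le_rpow hf hp0.le
    rw [ENNReal.rpow_inv_rpow hp0.ne', ENNReal.ofReal_rpow_of_pos hD] at this
    refine le_trans (le_of_eq (lintegral_congr fun x => ?_)) this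
    rw [← ofReal_norm, ENNReal.ofReal_rpow_of_nonneg (norm_nonneg _) hp0.le]
  set s : ℝ := (2 * D ^ p / t) ^ (p - 1)⁻¹ with hs
  have hs0 : 0 < s := by positivity
  have hsp : s ^ (1 - p) * D ^ p = t / 2 := by
    rw [show 1 - p = -(p - 1) by ring, Real.rpow_neg hs0.le, hs,
      Real.rpow_inv_rpow (by positivity) (by linarith)]
    have : 0 < D ^ p := by positivity
    field_simp
  have hset : NullMeasurableSet {x | s < ‖f x‖} volume :=
    nullMeasurableSet_lt aemeasurable_const hfm.norm.aemeasurable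
  set f₁ : V → ℂ := {x | s < ‖f x‖}.indicator f with hf₁
  set f₂ : V → ℂ := {x | s < ‖f x‖}ᶜ.indicator f with hf₂
  have hm₁ : AEStronglyMeasurable f₁ volume := hfm.indicator₀ hset
  have hm₂ : AEStronglyMeasurable f₂ volume := hfm.indicator₀ hset.compl
  have hb : ∀ (c : ℝ), 0 ≤ c →
      ∫⁻ x, ENNReal.ofReal (c * ‖f x‖ ^ p) ≤ ENNReal.ofReal (c * D ^ p) := fun c hc => by
    simp only [ENNReal.ofReal_mul hc]
    rw [lintegral_const_mul' _ _ ENNReal.ofReal_ne_top]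
    exact mul_le_mul_right hI _
  have hL1 : ∫⁻ x, ‖f₁ x‖ₑ ≤ ENNReal.ofReal (t / 2) := by
    rw [← hsp]
    refine (lintegral_mono fun x => ?_).trans (hb _ (by positivity))
    rw [← ofReal_norm]
    refine ENNReal.ofReal_le_ofReal ?_
    by_cases hx : s < ‖f x‖
    · have hx0 : 0 < ‖f x‖ := hs0.trans hx
      rw [hf₁, Set.indicator_of_mem (show x ∈ {x | s < ‖f x‖} from hx)]
      calc ‖f x‖ = ‖f x‖ ^ (1 - p) * ‖f x‖ ^ p := by
            rw [← Real.rpow_add hx0, sub_add_cancel, Real.rpow_one]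
        _ ≤ _ := by
          refine mul_le_mul_of_nonneg_right ?_ (by positivity)
          exact Real.rpow_le_rpow_of_nonpos hs0 hx.le (by linarith)
    · rw [hf₁, Set.indicator_of_notMem (show x ∉ {x | s < ‖f x‖} from hx), norm_zero]
      positivity
  have hL2 : ∫⁻ x, ‖f₂ x‖ₑ ^ (2 : ℝ) ≤ ENNReal.ofReal (s ^ (2 - p) * D ^ p) := by
    refine (lintegral_mono fun x => ?_).trans (hb _ (by positivity))
    rw [← ofReal_norm, ENNReal.ofReal_rpow_of_nonneg (norm_nonneg _) two_pos.le]
    refine ENNReal.ofReal_le_ofReal ?_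
    by_cases hx : s < ‖f x‖
    · rw [hf₂, Set.indicator_of_notMem (show x ∉ {x | s < ‖f x‖}ᶜ from not_not.2 hx), norm_zero,
        Real.zero_rpow two_ne_zero]
      positivity
    · rw [hf₂, Set.indicator_of_mem (show x ∈ {x | s < ‖f x‖}ᶜ from hx)]
      rcases (norm_nonneg (f x)).eq_or_lt with h0 | hx0
      · rw [← h0, Real.zero_rpow two_ne_zero]
        positivity
      calc ‖f x‖ ^ (2 : ℝ) = ‖f x‖ ^ (2 - p) * ‖f x‖ ^ p := by
            rw [← Real.rpow_add hx0, sub_add_cancel]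
        _ ≤ _ := by
          refine mul_le_mul_of_nonneg_right ?_ (by positivity)
          exact Real.rpow_le_rpow hx0.le (not_lt.1 hx) (by linarith)
  have hint₁ : Integrable f₁ := ⟨hm₁, hL1.trans_lt ENNReal.ofReal_lt_top⟩
  have hnorm₁ : ∫ x, ‖f₁ x‖ ≤ t / 2 := by
    rw [integral_norm_eq_lintegral_enorm hm₁]
    exact ENNReal.toReal_le_of_le_ofReal (by positivity) hL1
  have hsq : eLpNorm f₂ 2 volume ^ 2 = ∫⁻ x, ‖f₂ x‖ₑ ^ (2 : ℝ) := by
    rw [eLpNorm_eq_lintegral_rpow_enorm_toReal (by simp) (by simp), ENNReal.toReal_ofNat, one_div,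
      ← ENNReal.rpow_two, ENNReal.rpow_inv_rpow two_ne_zero]
  have hmem₂ : MemLp f₂ 2 := by
    refine ⟨hm₂, ?_⟩
    have : eLpNorm f₂ 2 volume ^ 2 < ⊤ := hsq ▸ hL2.trans_lt ENNReal.ofReal_lt_top
    exact (ENNReal.pow_lt_top_iff.1 this).resolve_right two_ne_zero
  have hmeas := h.measure_lt_le hint₁ hmem₂
    (fun x => (Set.indicator_self_add_compl_apply _ f x).symm) ht hnorm₁
  rw [hsq] at hmeas
  have hmeas' := hmeas.trans (mul_le_mul_right hL2 _)
  rw [← ENNReal.ofReal_mul (by positivity)] at hmeas'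
  refine (mul_le_mul_right (ENNReal.rpow_le_rpow hmeas' (by linarith)) _).trans ?_
  rw [ENNReal.ofReal_rpow_of_pos (by positivity), ← ENNReal.ofReal_mul ht.le]
  refine ENNReal.ofReal_le_ofReal (le_of_eq ?_)
  refine Real.log_injOn_pos (Set.mem_Ioi.2 (by positivity)) (Set.mem_Ioi.2 (by positivity)) ?_
  have hDp : 0 < D ^ p := by positivity
  rw [Real.log_mul (by positivity) (by positivity), Real.log_rpow (by positivity),
    Real.log_mul (by positivity) (by positivity), Real.log_mul (by positivity) (by positivity),
    Real.log_inv, Real.log_pow, Real.log_div (by positivity) (by positivity), Real.log_rpow hs0,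
    hs, Real.log_rpow (by positivity), Real.log_div (by positivity) (by positivity),
    Real.log_mul (by positivity) (by positivity), Real.log_rpow hD,
    Real.log_mul (by positivity) (by positivity), hup]
  have : p - 1 ≠ 0 := by linarith
  push_cast
  field_simp
  ring

/-- The weak-type Hausdorff–Young inequality for `1 ≤ p < 2`, where `p = 1 / u`. -/
theorem IsFourierDual.weakBound {f G : V → ℂ} (h : IsFourierDual f G) {u D : ℝ}
    (hu : 1 / 2 < u) (hu1 : u ≤ 1) (hD : 0 < D)
    (hf : eLpNorm f (ENNReal.ofReal u)⁻¹ volume ≤ ENNReal.ofReal D) :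
    WeakBound volume G (1 - u) (2 * D) := by
  rcases hu1.lt_or_eq with hu1 | rfl
  · exact h.weakBound_of_lt_one hu hu1 hD hf
  have hfm : AEStronglyMeasurable f volume := h.locallyIntegrable_left.aestronglyMeasurable
  simp only [ENNReal.ofReal_one, inv_one, eLpNorm_one_eq_lintegral_enorm] at hf
  rw [sub_self]
  refine (h.weakBound_zero ⟨hfm, hf.trans_lt ENNReal.ofReal_lt_top⟩).mono ?_
  rw [integral_norm_eq_lintegral_enorm hfm]
  exact (ENNReal.toReal_le_of_le_ofReal hD.le hf).trans (by linarith)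

end Duality

/-! ### The uncertainty inequality for weak norms -/

section Uncertainty

theorem exists_eLpNorm_le_of_weakBound_of_eLpNorm_le {α F : Type*} [MeasurableSpace α]
    {μ : Measure α} [NormedAddCommGroup F] {σ κ ρ : ℝ} (hσ : 0 ≤ σ) (hσκ : σ ≤ κ) (hκρ : κ < ρ) :
    ∃ C : ℝ, 0 < C ∧ ∀ (f : α → F), AEStronglyMeasurable f μ → ∀ A a : ℝ, 0 < A → 0 < a →
      WeakBound μ f ρ A → eLpNorm f (ENNReal.ofReal σ)⁻¹ μ ≤ ENNReal.ofReal a →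
      eLpNorm f (ENNReal.ofReal κ)⁻¹ μ ≤
        ENNReal.ofReal (C * (A ^ ((κ - σ) / (ρ - σ)) * a ^ (1 - (κ - σ) / (ρ - σ)))) := by
  rcases hσκ.lt_or_eq with hσκ | rfl
  · obtain ⟨C, hC, h⟩ := exists_eLpNorm_le_of_weakBound (μ := μ) (F := F) hσ (Or.inl hσκ) hκρ
    exact ⟨C, hC, fun f hf A a hA ha hwA hwa =>
      h f hf A a hA ha hwA (weakBound_of_eLpNorm_le hf hσ hwa)⟩
  · exact ⟨1, one_pos, fun f _ A a _ _ _ h => by simpa using h⟩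

variable {V : Type*} [NormedAddCommGroup V] [InnerProductSpace ℝ V] [FiniteDimensional ℝ V]
  [MeasurableSpace V] [BorelSpace V]

/-- Passing from `f` to its transform through `L^{1/u}`: the `L^{1/u}` norm of `f` is interpolated
between `L^{1/κ₁}` and the weak `L^{1/ρ₁}` norm, Hausdorff–Young bounds `G` in weak `L^{1/(1-u)}`,
and `‖G‖_{1/κ₂}` is interpolated between this and the weak `L^{1/ρ₂}` norm. -/
theorem exists_log_eLpNorm_fourier_le {κ₁ κ₂ ρ₁ ρ₂ u : ℝ} (hκ₁ : 0 ≤ κ₁) (hκu : κ₁ ≤ u)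
    (huρ : u < ρ₁) (hu : 1 / 2 < u) (hu1 : u ≤ 1) (huκ : 1 - u < κ₂ ∨ κ₂ = 0 ∧ 1 - u = 0)
    (hκ₂ : κ₂ < ρ₂) :
    ∃ c : ℝ, ∀ f G : V → ℂ, IsFourierDual f G → ∀ A B a b : ℝ, 0 < A → 0 < B → 0 < a → 0 < b →
      WeakBound volume f ρ₁ A → WeakBound volume G ρ₂ B →
      eLpNorm f (ENNReal.ofReal κ₁)⁻¹ volume = ENNReal.ofReal a →
      eLpNorm G (ENNReal.ofReal κ₂)⁻¹ volume = ENNReal.ofReal b →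
      Real.log b ≤ c + (κ₂ - (1 - u)) * ((Real.log B - Real.log b) / (ρ₂ - κ₂)) +
        (u - κ₁) * ((Real.log A - Real.log a) / (ρ₁ - κ₁)) + Real.log a := by
  obtain ⟨C, hC, h₁⟩ := exists_eLpNorm_le_of_weakBound_of_eLpNorm_le (μ := (volume : Measure V))
    (F := ℂ) hκ₁ hκu huρ
  obtain ⟨C', hC', h₂⟩ := exists_eLpNorm_le_of_weakBound (μ := (volume : Measure V)) (F := ℂ)
    (by linarith) huκ hκ₂
  have hd₁ : 0 < ρ₁ - κ₁ := by linarith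
  have hd₂ : 0 < ρ₂ - κ₂ := by linarith
  have hκ₂' : 1 - u ≤ κ₂ := by rcases huκ with h | ⟨h, h'⟩ <;> linarith
  have hd₂' : 0 < ρ₂ - (1 - u) := by linarith
  refine ⟨(Real.log C' * ((ρ₂ - (1 - u)) / (ρ₂ - κ₂))) + Real.log 2 + Real.log C, ?_⟩
  intro f G h A B a b hA hB ha hb hwA hwB hfa hGb
  set D : ℝ := C * (A ^ ((u - κ₁) / (ρ₁ - κ₁)) * a ^ (1 - (u - κ₁) / (ρ₁ - κ₁))) with hD
  have hD0 : 0 < D := by positivity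
  have hwG := h.weakBound hu hu1 hD0
    (h₁ f h.locallyIntegrable_left.aestronglyMeasurable A a hA ha hwA hfa.le)
  have hle := h₂ G h.locallyIntegrable_right.aestronglyMeasurable B (2 * D) hB (by positivity)
    hwB hwG
  rw [hGb, ENNReal.ofReal_le_ofReal_iff (by positivity)] at hle
  have hlog := Real.log_le_log hb hle
  have hlD : Real.log D = Real.log C + ((u - κ₁) / (ρ₁ - κ₁) * Real.log A +
      (1 - (u - κ₁) / (ρ₁ - κ₁)) * Real.log a) := by
    rw [hD, Real.log_mul (by positivity) (by positivity), Real.log_mul (by positivity)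
      (by positivity), Real.log_rpow hA, Real.log_rpow ha]
  rw [Real.log_mul (by positivity) (by positivity), Real.log_mul (by positivity) (by positivity),
    Real.log_rpow hB, Real.log_rpow (by positivity), Real.log_mul two_ne_zero hD0.ne'] at hlog
  have hlD' : Real.log D = Real.log C +
      (u - κ₁) * ((Real.log A - Real.log a) / (ρ₁ - κ₁)) + Real.log a := by
    rw [hlD]; ring
  -- solve the interpolation inequality for `log b`
  set η : ℝ := (κ₂ - (1 - u)) / (ρ₂ - (1 - u)) with hη
  have hmul := mul_le_mul_of_nonneg_right hlog
    (show 0 ≤ (ρ₂ - (1 - u)) / (ρ₂ - κ₂) by positivity)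
  have e1 : (1 - η) * ((ρ₂ - (1 - u)) / (ρ₂ - κ₂)) = 1 := by
    rw [hη]; field_simp; ring
  have e2 : η * ((ρ₂ - (1 - u)) / (ρ₂ - κ₂)) = (κ₂ - (1 - u)) / (ρ₂ - κ₂) := by
    rw [hη]; field_simp
  have e3 : (ρ₂ - (1 - u)) / (ρ₂ - κ₂) = 1 + (κ₂ - (1 - u)) / (ρ₂ - κ₂) := by
    field_simp; ring
  have hR : (Real.log C' + (η * Real.log B + (1 - η) * (Real.log 2 + Real.log D))) *
      ((ρ₂ - (1 - u)) / (ρ₂ - κ₂)) = Real.log C' * ((ρ₂ - (1 - u)) / (ρ₂ - κ₂)) +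
        (κ₂ - (1 - u)) / (ρ₂ - κ₂) * Real.log B + (Real.log 2 + Real.log D) := by
    rw [← e2]
    linear_combination (Real.log 2 + Real.log D) * e1
  rw [hR, hlD'] at hmul
  have hL : Real.log b * ((ρ₂ - (1 - u)) / (ρ₂ - κ₂)) =
      Real.log b + (κ₂ - (1 - u)) / (ρ₂ - κ₂) * Real.log b := by rw [e3]; ring
  rw [hL] at hmul
  have hX : (κ₂ - (1 - u)) * ((Real.log B - Real.log b) / (ρ₂ - κ₂)) =
      (κ₂ - (1 - u)) / (ρ₂ - κ₂) * Real.log B - (κ₂ - (1 - u)) / (ρ₂ - κ₂) * Real.log b := by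
    ring
  rw [hX]
  linarith

/-- The exponent `1 / u` at which Hausdorff–Young is applied.  The inequality `1 - u < κ₂` has to be
strict because only the weak-type bound is available, except at the endpoint `L^∞`. -/
theorem exists_admissible_exponent {κ₁ κ₂ ρ₁ : ℝ} (hκ₁ : κ₁ < ρ₁) (hκ₁1 : κ₁ ≤ 1) (hκ₂0 : 0 ≤ κ₂)
    (hρ₁ : 1 / 2 < ρ₁) (hκ₂ : 1 - ρ₁ < κ₂) :
    ∃ u, κ₁ ≤ u ∧ u < ρ₁ ∧ 1 / 2 < u ∧ u ≤ 1 ∧ (1 - u < κ₂ ∨ κ₂ = 0 ∧ 1 - u = 0) := by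
  obtain ⟨m, hm⟩ : ∃ m, m = max (max κ₁ (1 - κ₂)) (1 / 2) := ⟨_, rfl⟩
  have h1 : κ₁ ≤ m := hm ▸ (le_max_left _ _).trans (le_max_left _ _)
  have h2 : 1 - κ₂ ≤ m := hm ▸ (le_max_right _ _).trans (le_max_left _ _)
  have h3 : 1 / 2 ≤ m := hm ▸ le_max_right _ _
  have h4 : m ≤ 1 := hm ▸ max_le (max_le hκ₁1 (by linarith)) (by norm_num)
  have h5 : m < ρ₁ := hm ▸ max_lt (max_lt hκ₁ (by linarith)) hρ₁
  rcases h4.lt_or_eq with h6 | h6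
  · have h7 : m < min ρ₁ 1 := lt_min h5 h6
    have h8 := min_le_left ρ₁ 1
    have h9 := min_le_right ρ₁ 1
    exact ⟨(m + min ρ₁ 1) / 2, by linarith, by linarith, by linarith, by linarith,
      Or.inl (by linarith)⟩
  · refine ⟨1, hκ₁1, h6 ▸ h5, by norm_num, le_rfl, ?_⟩
    rcases hκ₂0.lt_or_eq with h | h
    · exact Or.inl (by linarith)
    · exact Or.inr ⟨h.symm, by norm_num⟩

theorem WeakBound.comp_neg {f : V → ℂ} {σ A : ℝ} (h : WeakBound volume f σ A) :
    WeakBound volume (fun x => f (-x)) σ A := by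
  intro t ht hm
  have e : volume {x | t < ‖f (-x)‖} = volume {x | t < ‖f x‖} :=
    Measure.measure_preimage_neg volume {x | t < ‖f x‖}
  rw [e] at hm ⊢
  exact h t ht hm

theorem eLpNorm_comp_neg_eq {f : V → ℂ} (hf : AEStronglyMeasurable f volume) (p : ℝ≥0∞) :
    eLpNorm (fun x => f (-x)) p volume = eLpNorm f p volume :=
  eLpNorm_comp_measurePreserving hf (Measure.measurePreserving_neg volume)

/-- The uncertainty inequality with weak norms in the numerators, in logarithmic form, for
Lebesgue exponents `1 / κᵢ ≥ 1`. -/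
theorem exists_le_log_of_le_one {κ₁ κ₂ ρ₁ ρ₂ : ℝ} (hκ₁0 : 0 ≤ κ₁) (hκ₂0 : 0 ≤ κ₂)
    (hκ₁1 : κ₁ ≤ 1) (hκ₂1 : κ₂ ≤ 1) (hκ₁ : κ₁ < ρ₁) (hκ₂ : κ₂ < ρ₂) (hρ₁ : 1 / 2 < ρ₁)
    (hρ₂ : 1 / 2 < ρ₂) (hκρ₁ : 1 - ρ₂ < κ₁) (hκρ₂ : 1 - ρ₁ < κ₂) :
    ∃ c : ℝ, ∀ f G : V → ℂ, IsFourierDual f G → ∀ A B a b : ℝ, 0 < A → 0 < B → 0 < a → 0 < b →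
      WeakBound volume f ρ₁ A → WeakBound volume G ρ₂ B →
      eLpNorm f (ENNReal.ofReal κ₁)⁻¹ volume = ENNReal.ofReal a →
      eLpNorm G (ENNReal.ofReal κ₂)⁻¹ volume = ENNReal.ofReal b →
      c ≤ (Real.log A - Real.log a) / (ρ₁ - κ₁) + (Real.log B - Real.log b) / (ρ₂ - κ₂) := by
  obtain ⟨u, hu1, hu2, hu3, hu4, hu5⟩ := exists_admissible_exponent hκ₁ hκ₁1 hκ₂0 hρ₁ hκρ₂
  obtain ⟨v, hv1, hv2, hv3, hv4, hv5⟩ := exists_admissible_exponent hκ₂ hκ₂1 hκ₁0 hρ₂ hκρ₁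
  obtain ⟨c, hc⟩ := exists_log_eLpNorm_fourier_le (V := V) hκ₁0 hu1 hu2 hu3 hu4 hu5 hκ₂
  obtain ⟨c', hc'⟩ := exists_log_eLpNorm_fourier_le (V := V) hκ₂0 hv1 hv2 hv3 hv4 hv5 hκ₁
  have huv : 0 < u + v - 1 := by linarith
  refine ⟨-(c + c') / (u + v - 1), fun f G h A B a b hA hB ha hb hwA hwB hfa hGb => ?_⟩
  have i₁ := hc f G h A B a b hA hB ha hb hwA hwB hfa hGb
  have i₂ := hc' G _ h.symm B A b a hB hA hb ha hwB hwA.comp_neg hGb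
    ((eLpNorm_comp_neg_eq h.locallyIntegrable_left.aestronglyMeasurable _).trans hfa)
  rw [div_le_iff₀ huv]
  -- adding the two estimates, the norms `a` and `b` cancel
  linarith

/-- Lowering the exponent of the denominator from `1 / σ` to `1 / κ` does not decrease the normalized
ratio, up to a constant. -/
theorem exists_log_div_le {α F : Type*} [MeasurableSpace α] {μ : Measure α}
    [NormedAddCommGroup F] {σ κ ρ : ℝ} (hσ : 0 ≤ σ) (hσκ : σ ≤ κ) (hκρ : κ < ρ) :
    ∃ c : ℝ, ∀ f : α → F, AEStronglyMeasurable f μ → ∀ A a a' : ℝ, 0 < A → 0 < a → 0 < a' →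
      WeakBound μ f ρ A → eLpNorm f (ENNReal.ofReal κ)⁻¹ μ = ENNReal.ofReal a →
      eLpNorm f (ENNReal.ofReal σ)⁻¹ μ = ENNReal.ofReal a' →
      (Real.log A - Real.log a') / (ρ - σ) ≤ c + (Real.log A - Real.log a) / (ρ - κ) := by
  obtain ⟨C, hC, h⟩ := exists_eLpNorm_le_of_weakBound_of_eLpNorm_le (μ := μ) (F := F) hσ hσκ hκρ
  have h1 : 0 < ρ - κ := by linarith
  have h2 : 0 < ρ - σ := by linarith
  refine ⟨Real.log C / (ρ - κ), fun f hf A a a' hA ha ha' hw hfa hfa' => ?_⟩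
  have hle := h f hf A a' hA ha' hw hfa'.le
  rw [hfa, ENNReal.ofReal_le_ofReal_iff (by positivity)] at hle
  have hlog := Real.log_le_log ha hle
  rw [Real.log_mul (by positivity) (by positivity), Real.log_mul (by positivity) (by positivity),
    Real.log_rpow hA, Real.log_rpow ha'] at hlog
  rw [← add_div, le_div_iff₀ h1]
  have e : (Real.log A - Real.log a') / (ρ - σ) * (ρ - κ) =
      Real.log A - ((κ - σ) / (ρ - σ) * Real.log A +
        (1 - (κ - σ) / (ρ - σ)) * Real.log a') := by
    field_simp; ring
  rw [e]
  linarith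

/-- Weak exponents `1 / σ > 1` and strong exponents `1 / κ < 1` together give integrability. -/
theorem eLpNorm_one_lt_top_of_weakBound {α F : Type*} [MeasurableSpace α] {μ : Measure α}
    [NormedAddCommGroup F] {σ κ A : ℝ} (hσ : 0 ≤ σ) (hσ1 : σ < 1) (hκ : 1 < κ) {f : α → F}
    (hf : MemLp f (ENNReal.ofReal κ)⁻¹ μ) (hA : 0 < A) (hw : WeakBound μ f σ A) :
    eLpNorm f 1 μ < ∞ := by
  obtain ⟨C, _, h⟩ := exists_eLpNorm_le_of_weakBound (μ := μ) (F := F) hσ (Or.inl hσ1) hκ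
  have hB : eLpNorm f (ENNReal.ofReal κ)⁻¹ μ ≤
      ENNReal.ofReal ((eLpNorm f (ENNReal.ofReal κ)⁻¹ μ).toReal + 1) := by
    conv_lhs => rw [← ENNReal.ofReal_toReal hf.2.ne]
    exact ENNReal.ofReal_le_ofReal (by linarith)
  have := h f hf.1 _ A (by positivity) hA (weakBound_of_eLpNorm_le hf.1 (by linarith) hB) hw
  rw [ENNReal.ofReal_one, inv_one] at this
  exact this.trans_lt ENNReal.ofReal_lt_top

theorem min_one_cases (κ : ℝ) : κ ≤ 1 ∧ min κ 1 = κ ∨ 1 < κ ∧ min κ 1 = 1 := by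
  rcases le_or_gt κ 1 with h | h
  · exact Or.inl ⟨h, min_eq_left h⟩
  · exact Or.inr ⟨h, min_eq_right h.le⟩

/-- Let `f` lie in `L^{max (1/κ₁) 1}` and in a weak Lebesgue space of exponent below two.  If its
transform `G` lies in `L^{1/κ₂}` with `1 / κ₂ < 1`, then `G` is integrable: by Hausdorff–Young it
also lies in a weak Lebesgue space of exponent above one. -/
theorem IsFourierDual.memLp_min_one {f G : V → ℂ} (h : IsFourierDual f G) {κ₁ κ₂ ρ₁ A : ℝ}
    (hκ₁0 : 0 ≤ κ₁) (hκ₁ : κ₁ < ρ₁) (hρ₁ : 1 / 2 < ρ₁) (hA : 0 < A)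
    (hw : WeakBound volume f ρ₁ A) (hf : MemLp f (ENNReal.ofReal (min κ₁ 1))⁻¹)
    (hG : MemLp G (ENNReal.ofReal κ₂)⁻¹) : MemLp G (ENNReal.ofReal (min κ₂ 1))⁻¹ := by
  rcases min_one_cases κ₂ with ⟨_, e⟩ | ⟨h2, e⟩
  · rwa [e]
  rw [e, ENNReal.ofReal_one, inv_one]
  refine ⟨hG.1, ?_⟩
  have hκρ : min κ₁ 1 < ρ₁ := (min_le_left _ _).trans_lt hκ₁
  obtain ⟨u, hu1, hu2, hu3, hu4, -⟩ := exists_admissible_exponent (κ₂ := 1) hκρ (min_le_right _ _)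
    zero_le_one hρ₁ (by linarith)
  obtain ⟨C, hC, hle⟩ := exists_eLpNorm_le_of_weakBound_of_eLpNorm_le
    (μ := (volume : Measure V)) (F := ℂ) (le_min hκ₁0 zero_le_one) hu1 hu2
  have hB : eLpNorm f (ENNReal.ofReal (min κ₁ 1))⁻¹ volume ≤
      ENNReal.ofReal ((eLpNorm f (ENNReal.ofReal (min κ₁ 1))⁻¹ volume).toReal + 1) := by
    conv_lhs => rw [← ENNReal.ofReal_toReal hf.2.ne]
    exact ENNReal.ofReal_le_ofReal (by linarith)
  have hwG := h.weakBound hu3 hu4 (by positivity) (hle f hf.1 A _ hA (by positivity) hw hB)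
  exact eLpNorm_one_lt_top_of_weakBound (by linarith) (by linarith) h2 hG (by positivity) hwG

theorem memLp_min_one_of_memLp {α F : Type*} [MeasurableSpace α] {μ : Measure α}
    [NormedAddCommGroup F] {f : α → F} {κ : ℝ} {p : ℝ≥0∞} (hp : 1 ≤ p) (hfp : MemLp f p μ)
    (hf : MemLp f (ENNReal.ofReal κ)⁻¹ μ) : MemLp f (ENNReal.ofReal (min κ 1))⁻¹ μ := by
  rcases min_one_cases κ with ⟨_, e⟩ | ⟨h1, e⟩
  · rwa [e]
  rw [e, ENNReal.ofReal_one, inv_one]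
  rcases hp.eq_or_lt with rfl | hp
  · exact hfp
  refine ⟨hf.1, ?_⟩
  have hp1 : p⁻¹ < 1 := ENNReal.inv_lt_one.2 hp
  have hpe : (ENNReal.ofReal p⁻¹.toReal)⁻¹ = p := by
    rw [ENNReal.ofReal_toReal hp1.ne_top, inv_inv]
  have hB : eLpNorm f (ENNReal.ofReal p⁻¹.toReal)⁻¹ μ ≤
      ENNReal.ofReal ((eLpNorm f p μ).toReal + 1) := by
    rw [hpe]
    conv_lhs => rw [← ENNReal.ofReal_toReal hfp.2.ne]
    exact ENNReal.ofReal_le_ofReal (by linarith)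
  refine eLpNorm_one_lt_top_of_weakBound ENNReal.toReal_nonneg ?_ h1 hf
    (A := (eLpNorm f p μ).toReal + 1) (by positivity)
    (weakBound_of_eLpNorm_le hf.1 ENNReal.toReal_nonneg hB)
  simpa using (ENNReal.toReal_lt_toReal hp1.ne_top ENNReal.one_ne_top).2 hp1

theorem memLp_comp_neg {f : V → ℂ} {p : ℝ≥0∞} (hf : MemLp f p) : MemLp (fun x => f (-x)) p :=
  hf.comp_measurePreserving (Measure.measurePreserving_neg volume)

/-- The uncertainty inequality with weak norms in the numerators, in logarithmic form.  Exponents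
below one are first raised to one. -/
theorem exists_le_log {κ₁ κ₂ ρ₁ ρ₂ : ℝ} (hκ₁0 : 0 ≤ κ₁) (hκ₂0 : 0 ≤ κ₂)
    (hκ₁ : κ₁ < ρ₁) (hκ₂ : κ₂ < ρ₂) (hρ₁ : 1 / 2 < ρ₁)
    (hρ₂ : 1 / 2 < ρ₂) (hκρ₁ : 1 - ρ₂ < κ₁) (hκρ₂ : 1 - ρ₁ < κ₂) :
    ∃ c : ℝ, ∀ f G : V → ℂ, IsFourierDual f G → ¬ f =ᵐ[volume] 0 → ¬ G =ᵐ[volume] 0 →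
      (∃ p : ℝ≥0∞, 1 ≤ p ∧ (MemLp f p volume ∨ MemLp G p volume)) →
      ∀ A B a b : ℝ, 0 < A → 0 < B → 0 < a → 0 < b →
      WeakBound volume f ρ₁ A → WeakBound volume G ρ₂ B →
      eLpNorm f (ENNReal.ofReal κ₁)⁻¹ volume = ENNReal.ofReal a →
      eLpNorm G (ENNReal.ofReal κ₂)⁻¹ volume = ENNReal.ofReal b →
      c ≤ (Real.log A - Real.log a) / (ρ₁ - κ₁) + (Real.log B - Real.log b) / (ρ₂ - κ₂) := by
  have hm : ∀ {κ ρ : ℝ}, κ < ρ → min κ 1 < ρ := fun h => (min_le_left _ _).trans_lt h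
  have hm0 : ∀ {κ : ℝ}, 0 ≤ κ → 0 ≤ min κ 1 := fun h => le_min h zero_le_one
  obtain ⟨c, hc⟩ := exists_le_log_of_le_one (V := V) (hm0 hκ₁0) (hm0 hκ₂0) (min_le_right κ₁ 1)
    (min_le_right κ₂ 1) (hm hκ₁) (hm hκ₂) hρ₁ hρ₂ (lt_min hκρ₁ (by linarith))
    (lt_min hκρ₂ (by linarith))
  obtain ⟨c₁, hc₁⟩ := exists_log_div_le (μ := (volume : Measure V)) (F := ℂ) (hm0 hκ₁0)
    (min_le_left κ₁ 1) hκ₁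
  obtain ⟨c₂, hc₂⟩ := exists_log_div_le (μ := (volume : Measure V)) (F := ℂ) (hm0 hκ₂0)
    (min_le_left κ₂ 1) hκ₂
  refine ⟨c - c₁ - c₂, fun f G h hf0 hG0 ⟨p, hp, hfG⟩ A B a b hA hB ha hb hwA hwB hfa hGb => ?_⟩
  have hfm := h.locallyIntegrable_left.aestronglyMeasurable
  have hGm := h.locallyIntegrable_right.aestronglyMeasurable
  have hf : MemLp f (ENNReal.ofReal κ₁)⁻¹ := ⟨hfm, hfa ▸ ENNReal.ofReal_lt_top⟩
  have hG : MemLp G (ENNReal.ofReal κ₂)⁻¹ := ⟨hGm, hGb ▸ ENNReal.ofReal_lt_top⟩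
  have hstep : MemLp f (ENNReal.ofReal (min κ₁ 1))⁻¹ → MemLp G (ENNReal.ofReal (min κ₂ 1))⁻¹ :=
    fun h' => h.memLp_min_one hκ₁0 hκ₁ hρ₁ hA hwA h' hG
  have hstep' : MemLp G (ENNReal.ofReal (min κ₂ 1))⁻¹ → MemLp f (ENNReal.ofReal (min κ₁ 1))⁻¹ :=
    fun h' => by
      have := memLp_comp_neg
        (h.symm.memLp_min_one hκ₂0 hκ₂ hρ₂ hB hwB h' (memLp_comp_neg hf))
      simpa using this
  obtain ⟨hf1, hG1⟩ : MemLp f (ENNReal.ofReal (min κ₁ 1))⁻¹ ∧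
      MemLp G (ENNReal.ofReal (min κ₂ 1))⁻¹ := by
    rcases hfG with h' | h'
    · have h1 := memLp_min_one_of_memLp hp h' hf
      exact ⟨h1, hstep h1⟩
    · have h1 := memLp_min_one_of_memLp hp h' hG
      exact ⟨hstep' h1, h1⟩
  have hpos : ∀ {k : V → ℂ} {κ : ℝ}, MemLp k (ENNReal.ofReal κ)⁻¹ → ¬ k =ᵐ[volume] 0 →
      0 < (eLpNorm k (ENNReal.ofReal κ)⁻¹ volume).toReal := fun hk hk0 =>
    ENNReal.toReal_pos (fun h0 => hk0 ((eLpNorm_eq_zero_iff hk.1 (by simp)).1 h0)) hk.2.ne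
  have i := hc f G h A B _ _ hA hB (hpos hf1 hf0) (hpos hG1 hG0) hwA hwB
    (ENNReal.ofReal_toReal hf1.2.ne).symm (ENNReal.ofReal_toReal hG1.2.ne).symm
  have i₁ := hc₁ f hfm A a _ hA ha (hpos hf1 hf0) hwA hfa (ENNReal.ofReal_toReal hf1.2.ne).symm
  have i₂ := hc₂ G hGm B b _ hB hb (hpos hG1 hG0) hwB hGb (ENNReal.ofReal_toReal hG1.2.ne).symm
  linarith

end Uncertainty

/-! ### Dilation to Mathlib's normalization -/

section Main

open FourierTransform

variable {n : ℕ}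

theorem fourierInt_two_pi_smul (φ : EuclideanSpace ℝ (Fin n) → ℂ)
    (ξ : EuclideanSpace ℝ (Fin n)) : fourierInt φ ((2 * Real.pi) • ξ) = 𝓕 φ ξ := by
  rw [fourierInt, Real.fourier_eq']
  refine integral_congr_ae (Filter.Eventually.of_forall fun x => ?_)
  simp only [smul_eq_mul, inner_smul_right]
  congr 2
  push_cast
  ring

theorem two_pi_pow_pos (n : ℕ) : (0 : ℝ) < (2 * Real.pi) ^ n := by positivity

theorem map_two_pi_smul : Measure.map (fun x : EuclideanSpace ℝ (Fin n) => (2 * Real.pi) • x)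
    volume = ENNReal.ofReal ((2 * Real.pi) ^ n)⁻¹ • volume := by
  rw [Measure.map_addHaar_smul _ (by positivity), finrank_euclideanSpace_fin,
    abs_of_pos (by positivity)]

/-- Rescaling by `2π` turns the non-unitary Fourier transform into Mathlib's. -/
theorem IsFourierPair.isFourierDual {f g : EuclideanSpace ℝ (Fin n) → ℂ} (h : IsFourierPair f g) :
    IsFourierDual f (fun ξ => g ((2 * Real.pi) • ξ)) := by
  intro φ
  have hpi : (2 * Real.pi) ≠ 0 := by positivity
  -- `ψ (ξ) = φ (ξ / 2π)`, so that `fourierInt ψ = (2π) ^ n 𝓕 φ`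
  set L : EuclideanSpace ℝ (Fin n) ≃L[ℝ] EuclideanSpace ℝ (Fin n) :=
    ContinuousLinearEquiv.smulLeft (Units.mk0 (2 * Real.pi)⁻¹ (inv_ne_zero hpi)) with hL
  have hLx : ∀ x, L x = (2 * Real.pi)⁻¹ • x := fun x => rfl
  set ψ : 𝓢(EuclideanSpace ℝ (Fin n), ℂ) :=
    SchwartzMap.compCLMOfContinuousLinearEquiv ℂ L φ with hψ
  have hψx : ∀ x, ψ x = φ ((2 * Real.pi)⁻¹ • x) := fun x => rfl
  have hψ2 : ∀ x, ψ ((2 * Real.pi) • x) = φ x := fun x => by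
    rw [hψx, inv_smul_smul₀ hpi]
  have hF : ∀ x, fourierInt ψ x = ((2 * Real.pi) ^ n : ℝ) • 𝓕 φ x := fun x => by
    rw [SchwartzMap.fourier_coe, ← fourierInt_two_pi_smul, fourierInt, fourierInt]
    have := Measure.integral_comp_smul (volume : Measure (EuclideanSpace ℝ (Fin n)))
      (fun y => Complex.exp (-(Complex.I * ((inner ℝ y x : ℝ) : ℂ))) * ψ y) (2 * Real.pi)
    simp only [hψ2, inner_smul_left, finrank_euclideanSpace_fin] at this
    rw [abs_of_pos (by positivity)] at this
    simp only [inner_smul_right]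
    simp only [RCLike.conj_to_real] at this
    rw [this, smul_smul, mul_inv_cancel₀ (two_pi_pow_pos n).ne', one_smul]
  obtain ⟨-, h⟩ := h
  refine ⟨(h φ).1, ?_, ?_⟩
  · have := (h ψ).2.1.comp_smul hpi
    simpa only [hψ2] using this
  · have h1 := (h ψ).2.2
    have h2 := Measure.integral_comp_smul (volume : Measure (EuclideanSpace ℝ (Fin n)))
      (fun y => g y * ψ y) (2 * Real.pi)
    simp only [hψ2, finrank_euclideanSpace_fin] at h2
    rw [abs_of_pos (by positivity), ← h1] at h2
    rw [h2]
    simp only [hF, mul_smul_comm]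
    rw [integral_smul, smul_smul, inv_mul_cancel₀ (two_pi_pow_pos n).ne', one_smul]

theorem WeakBound.comp_two_pi_smul {g : EuclideanSpace ℝ (Fin n) → ℂ} {σ A : ℝ} (hσ : 0 ≤ σ)
    (h : WeakBound volume g σ A) : WeakBound volume (fun ξ => g ((2 * Real.pi) • ξ)) σ A := by
  intro t ht hm
  have e : volume {x | t < ‖g ((2 * Real.pi) • x)‖} =
      ENNReal.ofReal ((2 * Real.pi) ^ n)⁻¹ * volume {x | t < ‖g x‖} := by
    have := Measure.addHaar_preimage_smul (volume : Measure (EuclideanSpace ℝ (Fin n)))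
      (r := 2 * Real.pi) (by positivity) {x | t < ‖g x‖}
    rwa [finrank_euclideanSpace_fin, abs_of_pos (by positivity)] at this
  have hle : volume {x | t < ‖g ((2 * Real.pi) • x)‖} ≤ volume {x | t < ‖g x‖} := by
    rw [e]
    refine mul_le_of_le_one_left' (ENNReal.ofReal_le_one.2 (inv_le_one_of_one_le₀ ?_))
    exact one_le_pow₀ (by linarith [Real.pi_gt_three])
  have hm' : volume {x | t < ‖g x‖} ≠ 0 := fun h0 => hm (by rw [e, h0, mul_zero])
  exact (mul_le_mul_right (ENNReal.rpow_le_rpow hle hσ) _).trans (h t ht hm')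

theorem eLpNorm_comp_two_pi_smul {g : EuclideanSpace ℝ (Fin n) → ℂ}
    (hg : AEStronglyMeasurable g volume) {κ : ℝ} (hκ : 0 ≤ κ) :
    eLpNorm (fun ξ => g ((2 * Real.pi) • ξ)) (ENNReal.ofReal κ)⁻¹ volume =
      ENNReal.ofReal ((((2 * Real.pi) ^ n)⁻¹) ^ κ) * eLpNorm g (ENNReal.ofReal κ)⁻¹ volume := by
  have hc : ENNReal.ofReal ((2 * Real.pi) ^ n)⁻¹ ≠ 0 := by
    simpa using inv_pos.2 (two_pi_pow_pos n)
  have hg' : AEStronglyMeasurable g (Measure.map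
      (fun x : EuclideanSpace ℝ (Fin n) => (2 * Real.pi) • x) volume) := by
    rw [map_two_pi_smul]; exact hg.smul_measure _
  have h1 := eLpNorm_map_measure (p := (ENNReal.ofReal κ)⁻¹) hg'
    (measurable_const_smul (2 * Real.pi)).aemeasurable
  rw [map_two_pi_smul, eLpNorm_smul_measure_of_ne_zero hc] at h1
  refine h1.symm.trans ?_
  rw [smul_eq_mul, one_div, inv_inv, ENNReal.toReal_ofReal hκ,
    ENNReal.ofReal_rpow_of_pos (inv_pos.2 (two_pi_pow_pos n))]

theorem IsFourierPair.exists_memLp_comp {f g : EuclideanSpace ℝ (Fin n) → ℂ}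
    (h : IsFourierPair f g) : ∃ p : ℝ≥0∞, 1 ≤ p ∧
      (MemLp f p volume ∨ MemLp (fun ξ => g ((2 * Real.pi) • ξ)) p volume) := by
  obtain ⟨⟨p, hp, hfg⟩, -⟩ := h
  refine ⟨p, hp, hfg.imp_right fun hg => ?_⟩
  have hm : MemLp g p (Measure.map
      (fun x : EuclideanSpace ℝ (Fin n) => (2 * Real.pi) • x) volume) := by
    rw [map_two_pi_smul]; exact hg.smul_measure ENNReal.ofReal_ne_top
  exact hm.comp_of_map (measurable_const_smul (2 * Real.pi)).aemeasurable

/-! ### The exponents in reciprocal form -/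

theorem inv_critExp {a : ℝ≥0∞} {b : ℝ} (hn : 0 < n) (ha : 0 < a) (hb : 0 < b) :
    (critExp n a b)⁻¹ = ENNReal.ofReal (a⁻¹.toReal + b / n) := by
  have hn0 : (n : ℝ≥0∞) ≠ 0 := by exact_mod_cast hn.ne'
  have ha' : a⁻¹ ≠ ∞ := by simpa using ha.ne'
  rw [critExp, ENNReal.inv_div (Or.inr (by simp)) (Or.inr hn0),
    ENNReal.ofReal_add ENNReal.toReal_nonneg (by positivity), ENNReal.ofReal_toReal ha',
    ENNReal.ofReal_div_of_pos (by exact_mod_cast hn), ENNReal.ofReal_natCast, ENNReal.add_div,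
    ENNReal.mul_div_cancel_right hn0 (by simp)]

theorem one_half_lt_of_critExp_lt_two {a : ℝ≥0∞} {b : ℝ} (hn : 0 < n) (ha : 0 < a) (hb : 0 < b)
    (h : critExp n a b < 2) : 1 / 2 < a⁻¹.toReal + b / n := by
  rw [← ENNReal.inv_lt_inv, inv_critExp hn ha hb] at h
  have := (ENNReal.lt_ofReal_iff_toReal_lt (by simp)).1 h
  simpa using this

theorem toReal_inv_lt_of_critExp_lt {a k : ℝ≥0∞} {b : ℝ} (hn : 0 < n) (ha : 0 < a) (hb : 0 < b)
    (h : critExp n a b < k) : k⁻¹.toReal < a⁻¹.toReal + b / n := by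
  have hk : k ≠ 0 := (zero_le.trans_lt h).ne'
  rw [← ENNReal.inv_lt_inv, inv_critExp hn ha hb] at h
  exact (ENNReal.lt_ofReal_iff_toReal_lt (by simpa using hk)).1 h

/-- In reciprocals, the condition `k < r'` reads `1 - 1 / r < 1 / k`; for `r < 1` this inequality
holds automatically. -/
theorem one_sub_lt_toReal_inv {a k : ℝ≥0∞} {b : ℝ} (hn : 0 < n) (ha : 0 < a) (hb : 0 < b)
    (hk : k ≠ 0) (h : 1 ≤ critExp n a b → k < (critExp n a b).conjExponent) :
    1 - (a⁻¹.toReal + b / n) < k⁻¹.toReal := by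
  have hinv := inv_critExp hn ha hb
  have hpos : 0 < a⁻¹.toReal + b / n := by positivity
  rcases le_or_gt 1 (critExp n a b) with h1 | h1
  · have hlt := h h1
    have := ENNReal.HolderConjugate.conjExponent h1
    have hsum := ENNReal.HolderConjugate.inv_add_inv_eq_one (critExp n a b)
      (critExp n a b).conjExponent
    have hle : (critExp n a b).conjExponent⁻¹ ≤ 1 := hsum ▸ le_add_self
    have hreal := congrArg ENNReal.toReal hsum
    rw [ENNReal.toReal_add (by rw [hinv]; simp) (hle.trans_lt ENNReal.one_lt_top).ne, hinv,
      ENNReal.toReal_ofReal hpos.le, ENNReal.toReal_one] at hreal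
    have := (ENNReal.toReal_lt_toReal (hle.trans_lt ENNReal.one_lt_top).ne (by simpa using hk)).2
      (ENNReal.inv_lt_inv.2 hlt)
    linarith
  · have h2 : (1 : ℝ≥0∞) < ENNReal.ofReal (a⁻¹.toReal + b / n) := by
      rw [← hinv]; exact ENNReal.one_lt_inv.2 h1
    have h3 : 1 < a⁻¹.toReal + b / n := by
      simpa using (ENNReal.lt_ofReal_iff_toReal_lt (by simp)).1 h2
    have := ENNReal.toReal_nonneg (a := k⁻¹)
    linarith

theorem moment_ne_zero (hn : 0 < n) {a : ℝ≥0∞} {b : ℝ} (ha : 0 < a) (hb : 0 < b)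
    {f : EuclideanSpace ℝ (Fin n) → ℂ} (hf : AEStronglyMeasurable f volume)
    (hf0 : ¬ f =ᵐ[volume] 0) (x₀ : EuclideanSpace ℝ (Fin n)) :
    eLpNorm (fun x => ((‖x - x₀‖ ^ b : ℝ) : ℂ) * f x) a volume ≠ 0 := by
  have : Nonempty (Fin n) := ⟨⟨0, hn⟩⟩
  have hmeas : AEStronglyMeasurable (fun x => ((‖x - x₀‖ ^ b : ℝ) : ℂ) * f x) volume := by
    refine AEStronglyMeasurable.mul (Continuous.aestronglyMeasurable ?_) hf
    exact Complex.continuous_ofReal.comp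
      ((continuous_id.sub continuous_const).norm.rpow_const fun _ => Or.inr hb.le)
  intro h0
  refine hf0 ?_
  have hne : ∀ᵐ x : EuclideanSpace ℝ (Fin n), x ≠ x₀ := by
    simp [ae_iff]
  filter_upwards [(eLpNorm_eq_zero_iff hmeas ha.ne').1 h0, hne] with x hx hx₀
  have hw : 0 < ‖x - x₀‖ ^ b := Real.rpow_pos_of_pos (norm_pos_iff.2 (sub_ne_zero.2 hx₀)) _
  simpa [hw.ne'] using hx

end Main

/-! ### The uncertainty inequality -/

theorem theorem2 (n : ℕ) (hn : 0 < n) (a₁ a₂ k₁ k₂ : ℝ≥0∞) (b₁ b₂ : ℝ)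
    (ha₁ : 0 < a₁) (ha₂ : 0 < a₂) (hb₁ : 0 < b₁) (hb₂ : 0 < b₂)
    (hr₁ : critExp n a₁ b₁ < 2) (hr₂ : critExp n a₂ b₂ < 2)
    (hk₁ : critExp n a₁ b₁ < k₁)
    (hk₁' : 1 ≤ critExp n a₂ b₂ → k₁ < (critExp n a₂ b₂).conjExponent)
    (hk₂ : critExp n a₂ b₂ < k₂)
    (hk₂' : 1 ≤ critExp n a₁ b₁ → k₂ < (critExp n a₁ b₁).conjExponent) :
    ∃ C : ℝ, 0 < C ∧
      ∀ f g : EuclideanSpace ℝ (Fin n) → ℂ,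
        MemLp f k₁ volume → MemLp g k₂ volume → IsFourierPair f g → ¬ f =ᵐ[volume] 0 →
        ∀ x₀ ξ₀ : EuclideanSpace ℝ (Fin n),
          ENNReal.ofReal C ≤
            momentRatio a₁ b₁ k₁ x₀ f ^ gapExp n a₂ b₂ k₂ *
            momentRatio a₂ b₂ k₂ ξ₀ g ^ gapExp n a₁ b₁ k₁ := by
  have hρ₁ := one_half_lt_of_critExp_lt_two hn ha₁ hb₁ hr₁
  have hρ₂ := one_half_lt_of_critExp_lt_two hn ha₂ hb₂ hr₂
  have hκ₁ := toReal_inv_lt_of_critExp_lt hn ha₁ hb₁ hk₁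
  have hκ₂ := toReal_inv_lt_of_critExp_lt hn ha₂ hb₂ hk₂
  have hk₁0 : k₁ ≠ 0 := (zero_le.trans_lt hk₁).ne'
  have hk₂0 : k₂ ≠ 0 := (zero_le.trans_lt hk₂).ne'
  have hκρ₁ := one_sub_lt_toReal_inv hn ha₂ hb₂ hk₁0 hk₁'
  have hκρ₂ := one_sub_lt_toReal_inv hn ha₁ hb₁ hk₂0 hk₂'
  have hke : ∀ {k : ℝ≥0∞}, k ≠ 0 → (ENNReal.ofReal k⁻¹.toReal)⁻¹ = k := fun hk => by
    rw [ENNReal.ofReal_toReal (by simpa using hk), inv_inv]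
  have hke₁ := hke hk₁0
  have hke₂ := hke hk₂0
  have hκ₁0 : 0 ≤ k₁⁻¹.toReal := ENNReal.toReal_nonneg
  have hκ₂0 : 0 ≤ k₂⁻¹.toReal := ENNReal.toReal_nonneg
  obtain ⟨c, hc⟩ := exists_le_log (V := EuclideanSpace ℝ (Fin n)) hκ₁0 hκ₂0 hκ₁ hκ₂ hρ₁ hρ₂
    hκρ₁ hκρ₂
  obtain ⟨C₁, hC₁, hm₁⟩ := exists_weakBound_of_moment hn ha₁ hb₁
  obtain ⟨C₂, hC₂, hm₂⟩ := exists_weakBound_of_moment hn ha₂ hb₂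
  have hd₁ : gapExp n a₁ b₁ k₁ = a₁⁻¹.toReal + b₁ / n - k₁⁻¹.toReal := rfl
  have hd₂ : gapExp n a₂ b₂ k₂ = a₂⁻¹.toReal + b₂ / n - k₂⁻¹.toReal := rfl
  generalize hρ₁e : a₁⁻¹.toReal + b₁ / n = ρ₁ at *
  generalize hρ₂e : a₂⁻¹.toReal + b₂ / n = ρ₂ at *
  generalize hκ₁e : k₁⁻¹.toReal = κ₁ at *
  generalize hκ₂e : k₂⁻¹.toReal = κ₂ at *
  generalize gapExp n a₁ b₁ k₁ = d₁ at *
  generalize gapExp n a₂ b₂ k₂ = d₂ at *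
  have hd₁0 : 0 < d₁ := by linarith
  have hd₂0 : 0 < d₂ := by linarith
  -- the dilation factor between the norms of `g` and of `g (2π ·)`
  obtain ⟨δ, hδ⟩ : ∃ δ : ℝ, δ = (((2 * Real.pi) ^ n)⁻¹) ^ κ₂ := ⟨_, rfl⟩
  have hδ0 : 0 < δ := hδ ▸ Real.rpow_pos_of_pos (inv_pos.2 (two_pi_pow_pos n)) _
  refine ⟨Real.exp (d₁ * d₂ * c - d₂ * Real.log C₁ - d₁ * Real.log C₂ + d₁ * Real.log δ),
    Real.exp_pos _, fun f g hf hg hfg hf0 x₀ ξ₀ => ?_⟩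
  have hdual := hfg.isFourierDual
  have hG0 : ¬ (fun ξ => g ((2 * Real.pi) • ξ)) =ᵐ[volume] 0 := fun h0 =>
    hf0 (hdual.ae_eq_zero h0)
  have hGm := hdual.locallyIntegrable_right.aestronglyMeasurable
  have hGn := eLpNorm_comp_two_pi_smul hg.1 hκ₂0
  have hGn0 : eLpNorm (fun ξ => g ((2 * Real.pi) • ξ)) (ENNReal.ofReal κ₂)⁻¹ volume ≠ 0 :=
    fun h0 => hG0 ((eLpNorm_eq_zero_iff hGm (by simp)).1 h0)
  rw [hke₁, hke₂] at hc
  rw [hke₂] at hGn hGn0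
  rw [← hδ] at hGn
  have hgn0 : eLpNorm g k₂ volume ≠ 0 := fun h0 => hGn0 (by rw [hGn, h0, mul_zero])
  have hg0 : ¬ g =ᵐ[volume] 0 := fun h0 => hgn0 ((eLpNorm_eq_zero_iff hg.1 hk₂0).2 h0)
  have hfn0 : eLpNorm f k₁ volume ≠ 0 := fun h0 => hf0 ((eLpNorm_eq_zero_iff hf.1 hk₁0).1 h0)
  have hA0 := moment_ne_zero hn ha₁ hb₁ hf.1 hf0 x₀
  have hB0 := moment_ne_zero hn ha₂ hb₂ hg.1 hg0 ξ₀
  unfold momentRatio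
  have hm₁' := hm₁ f hf.1 x₀
  have hm₂' := hm₂ g hg.1 ξ₀
  generalize eLpNorm (fun x => ((‖x - x₀‖ ^ b₁ : ℝ) : ℂ) * f x) a₁ volume = A at *
  generalize eLpNorm (fun x => ((‖x - ξ₀‖ ^ b₂ : ℝ) : ℂ) * g x) a₂ volume = B at *
  have hfn := hf.2.ne
  have hgn := hg.2.ne
  have hratio : ∀ {x y : ℝ≥0∞}, x ≠ 0 → y ≠ ∞ → x / y ≠ 0 := fun hx hy =>
    ENNReal.div_ne_zero.2 ⟨hx, hy⟩
  have hpow : ∀ {x : ℝ≥0∞} {d : ℝ}, x ≠ 0 → 0 < d → x ^ d ≠ 0 := fun hx hd h0 =>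
    hx ((ENNReal.rpow_eq_zero_iff_of_pos hd).1 h0)
  rcases eq_or_ne A ∞ with rfl | hAt
  · rw [ENNReal.top_div_of_ne_top hfn, ENNReal.top_rpow_of_pos hd₂0,
      ENNReal.top_mul (hpow (hratio hB0 hgn) hd₁0)]
    exact le_top
  rcases eq_or_ne B ∞ with rfl | hBt
  · rw [ENNReal.top_div_of_ne_top hgn, ENNReal.top_rpow_of_pos hd₁0,
      ENNReal.mul_top (hpow (hratio hA0 hfn) hd₂0)]
    exact le_top
  have hA := ENNReal.toReal_pos hA0 hAt
  have hB := ENNReal.toReal_pos hB0 hBt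
  have ha := ENNReal.toReal_pos hfn0 hfn
  have hb := ENNReal.toReal_pos hgn0 hgn
  have hAe := ENNReal.ofReal_toReal hAt
  have hBe := ENNReal.ofReal_toReal hBt
  have hae := ENNReal.ofReal_toReal hfn
  have hbe := ENNReal.ofReal_toReal hgn
  have hlow := hc f _ hdual hf0 hG0 hfg.exists_memLp_comp _ _ _ (δ * (eLpNorm g k₂ volume).toReal)
    (by positivity) (by positivity) ha (by positivity) (hm₁' A.toReal hA hAe.ge)
    ((hm₂' B.toReal hB hBe.ge).comp_two_pi_smul (by linarith)) hae.symm
    (by rw [hGn, ENNReal.ofReal_mul hδ0.le, hbe])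
  rw [← hAe, ← hBe, ← hae, ← hbe]
  generalize A.toReal = A' at *
  generalize B.toReal = B' at *
  generalize (eLpNorm f k₁ volume).toReal = a' at *
  generalize (eLpNorm g k₂ volume).toReal = b' at *
  rw [← ENNReal.ofReal_div_of_pos ha, ← ENNReal.ofReal_div_of_pos hb,
    ENNReal.ofReal_rpow_of_pos (by positivity), ENNReal.ofReal_rpow_of_pos (by positivity),
    ← ENNReal.ofReal_mul (by positivity)]
  refine ENNReal.ofReal_le_ofReal ((Real.le_log_iff_exp_le (by positivity)).1 ?_)
  rw [Real.log_mul (by positivity) (by positivity), Real.log_rpow (div_pos hA ha),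
    Real.log_rpow (div_pos hB hb), Real.log_div hA.ne' ha.ne', Real.log_div hB.ne' hb.ne']
  rw [Real.log_mul hC₁.ne' hA.ne', Real.log_mul hC₂.ne' hB.ne', Real.log_mul hδ0.ne' hb.ne',
    ← hd₁, ← hd₂] at hlow
  have hmul := mul_le_mul_of_nonneg_left hlow (mul_pos hd₁0 hd₂0).le
  have e : d₁ * d₂ * ((Real.log C₁ + Real.log A' - Real.log a') / d₁ +
      (Real.log C₂ + Real.log B' - (Real.log δ + Real.log b')) / d₂) =
      d₂ * (Real.log C₁ + Real.log A' - Real.log a') +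
        d₁ * (Real.log C₂ + Real.log B' - (Real.log δ + Real.log b')) := by
    field_simp
  rw [e] at hmul
  linarith
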